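/- Fix an integer $b\ge 2$. For $n\in\mathbb{N}$ let $T_n$ be the $b$-ary tree of height $n$ (an apex, every vertex at distance less than $n$ from the apex having exactly $b$ children), and let $L_n$ be its set of $b^n$ leaves, i.e. the vertices at distance $n$ from the apex. For $\lambda\ge 0$ the Poisson particle model $\Gamma_n(\lambda)$ is the following random multigraph with vertex set $L_n$. At each $v\in L_n$ start a random number of particles, these numbers being i.i.d. Poisson random variables with mean $\lambda/2$. The particles perform independent simple random walks on $T_n$, each stopped at its first return to $L_n$ (at a time $\ge 1$). For each particle, put an edge between the leaf at which it started and the leaf at which it stopped. Let $\sigma_{\mathrm{crit}}=\frac{b+1}{b-1}\log b$, where $\log$ is the natural logarithm. \textbf{Theorem.} (1) For every fixed real $\alpha>b+1$, $\mathbb{P}\bigl(\Gamma_n(\sigma_{\mathrm{crit}}\,n+\alpha\log n)\text{ is connected}\bigr)\to 1$ as $n\to\infty$. (2) For every fixed real $\beta>\frac{b+1}{b-1}$, $\mathbb{P}\bigl(\Gamma_n(\sigma_{\mathrm{crit}}\,n-\beta\log n)\text{ is not connected}\bigr)\to 1$ as $n\to\infty$ (the parameter is nonnegative for all sufficiently large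 $n$, and only such $n$ matter). -/

import Mathlib

open MeasureTheory ProbabilityTheory Filter Topology

noncomputable section

namespace ParticleModel

section RandomWalk

variable {V : Type*} [MeasurableSpace V] [DiscreteMeasurableSpace V] [Finite V]

/-- One step of simple random walk on a finite graph `G` from the vertex `v`: the uniform
distribution on the neighbours of `v`. (A walk at a vertex without neighbours stays put.) -/
def stepMeasure (G : SimpleGraph V) (v : V) : Measure V :=
  open Classical in
  if (G.neighborSet v).Nonempty then uniformOn (G.neighborSet v) else Measure.dirac v

instance (G : SimpleGraph V) (v : V) : IsProbabilityMeasure (stepMeasure G v) := by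
  unfold stepMeasure
  split_ifs with h
  · exact isProbabilityMeasure_uniformOn (Set.toFinite _) h
  · infer_instance

/-- The transition kernel of simple random walk on `G`. -/
def stepKernel (G : SimpleGraph V) : Kernel V V where
  toFun := stepMeasure G
  measurable' := Measurable.of_discrete

instance (G : SimpleGraph V) : IsMarkovKernel (stepKernel G) :=
  ⟨fun v => inferInstanceAs (IsProbabilityMeasure (stepMeasure G v))⟩

/-- The law of the position at time `t + 1` given the trajectory up to time `t`: a step from the
position at time `t`. -/
def historyKernel (G : SimpleGraph V) (t : ℕ) : Kernel (Finset.Iic t → V) V :=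
  (stepKernel G).comap (fun h => h ⟨t, Finset.mem_Iic.2 le_rfl⟩) (measurable_pi_apply _)

instance (G : SimpleGraph V) (t : ℕ) : IsMarkovKernel (historyKernel G t) := by
  unfold historyKernel
  infer_instance

/-- The law, on trajectories `ℕ → V`, of simple random walk on `G` started at `v`. -/
def walkLaw (G : SimpleGraph V) (v : V) : Measure (ℕ → V) :=
  Kernel.trajMeasure (X := fun _ => V) (Measure.dirac v) (historyKernel G)

instance (G : SimpleGraph V) (v : V) : IsProbabilityMeasure (walkLaw G v) := by
  unfold walkLaw
  infer_instance

end RandomWalk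

/-- The vertices of the `b`-ary tree of height `n`: words of length at most `n` over `b` letters.
The empty word is the apex, and the parent of `a :: w` is `w`. -/
def Vertex (b n : ℕ) : Type := {w : List (Fin b) // w.length ≤ n}

instance (b n : ℕ) : Finite (Vertex b n) := (List.finite_length_le (Fin b) n).to_subtype

instance (b n : ℕ) : MeasurableSpace (Vertex b n) := ⊤

instance (b n : ℕ) : DiscreteMeasurableSpace (Vertex b n) := ⟨fun _ => trivial⟩

/-- The `b`-ary tree `T_n` of height `n`. -/
def tree (b n : ℕ) : SimpleGraph (Vertex b n) where
  Adj u v := (∃ a, u.1 = a :: v.1) ∨ ∃ a, v.1 = a :: u.1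
  symm := ⟨fun _ _ h => h.symm⟩
  loopless := ⟨fun u h => by
    rcases h with ⟨a, h⟩ | ⟨a, h⟩ <;> simpa using congrArg List.length h⟩

/-- The set `L_n` of leaves of `T_n`: the vertices at distance `n` from the apex. -/
def leaves (b n : ℕ) : Set (Vertex b n) := {v | v.1.length = n}

instance (b n : ℕ) : Fintype (leaves b n) := Fintype.ofFinite _

/-- The trajectory `X` is at `y` at the time of its first return to the leaves. -/
def EndsAt {b n : ℕ} (X : ℕ → Vertex b n) (y : leaves b n) : Prop :=
  ∃ t, 1 ≤ t ∧ X t = y ∧ ∀ s, 1 ≤ s → s < t → X s ∉ leaves b n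

/-- Outcomes of the experiment: for each leaf `x`, the number `(ω x).1` of particles started at
`x`, and the trajectories `(ω x).2 i`. Only the trajectories with index `i < (ω x).1` are used. -/
abbrev Outcome (b n : ℕ) : Type := leaves b n → ℕ × (ℕ → ℕ → Vertex b n)

/-- The law of the experiment: all particle numbers and trajectories are independent, the number
of particles at each leaf is Poisson with mean `l / 2` (read as `0` if `l < 0`), and the particles
started at `x` perform simple random walks on `T_n` from `x`. -/
def law (b n : ℕ) (l : ℝ) : Measure (Outcome b n) :=
  Measure.pi fun x =>
    (poissonMeasure (l / 2).toNNReal).prod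
      (Measure.infinitePi fun _ : ℕ => walkLaw (tree b n) x.1)

/-- The multigraph on the leaves of `T_n` in which each particle `p = (x, i)` is an edge that joins
the leaf `x` where it starts to the leaf where its walk first returns to the leaves. -/
def multigraph {b n : ℕ} (ω : Outcome b n) : Graph (leaves b n) (leaves b n × ℕ) where
  vertexSet := Set.univ
  IsLink p x y := p.2 < (ω p.1).1 ∧ ∃ z, EndsAt ((ω p.1).2 p.2) z ∧ s(p.1, z) = s(x, y)
  isLink_symm := fun _ _ => ⟨fun x y ⟨h, z, hz, e⟩ => ⟨h, z, hz, e.trans Sym2.eq_swap⟩⟩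
  eq_or_eq_of_isLink_of_isLink := by
    rintro p x y v w ⟨-, z, ⟨t, ht, hz, hlt⟩, e⟩ ⟨-, z', ⟨t', ht', hz', hlt'⟩, e'⟩
    have htt : t = t' := by
      rcases lt_trichotomy t t' with h | h | h
      · exact absurd (hz ▸ z.2) (hlt' t ht h)
      · exact h
      · exact absurd (hz' ▸ z'.2) (hlt t' ht' h)
    have hzz : z = z' := Subtype.ext (hz.symm.trans (htt ▸ hz'))
    subst hzz
    rcases Sym2.eq_iff.1 (e.symm.trans e') with h | h
    · exact Or.inl h.1
    · exact Or.inr h.1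
  left_mem_of_isLink := fun _ _ _ _ => Set.mem_univ _

/-- The event that the random multigraph is connected. -/
def connectedEvent (b n : ℕ) : Set (Outcome b n) :=
  {ω | (SimpleGraph.fromRel (multigraph ω).Adj).Connected}

/-- The constant `σ_crit = (b + 1) / (b - 1) * log b`. -/
def sigmaCrit (b : ℕ) : ℝ := ((b : ℝ) + 1) / ((b : ℝ) - 1) * Real.log b

end ParticleModel

end

/-! The multigraph is disconnected exactly when some nonempty proper set S of leaves has no edge to
its complement. Thinning the Poisson particles gives this event probability exp(-l * `rate (Cuts
S)`) (`law_noEdge`). Optional stopping at the first return to the leaves (`sum_returnProb_mul`)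
identifies the rate with the Dirichlet energy of the harmonic extension of the indicator of S
(`rate_cuts`). Everything is thus reduced to energies of subsets of the leaves.

The rate is at least `capacity b * (energy - density ^ 2)` (`capacity_mul_le_rate`), where `energy`
is computed as if the tree were infinite. It is unaffected by adding empty siblings, equals 1 for a
full subtree, and is at least 1 for every nonempty set (`Config.one_le_energy`). Since `sigmaCrit b
* capacity b = log b`, the parameter L = l * capacity is n log b up to a multiple of log n, and b^n
e^{-L} is a power of n.

Connected regime: a union bound over cuts of density at most 1/2. Configurations are given the
weight density * exp(-L (energy - 1)), under which the full subtrees of any one height contribute 1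
in total. Let Z_h be the sum of all weights at height h. In the passage to height h + 1, the full
configuration contributes at most 1, configurations with one occupied branch contribute at most Z_h,
and all others are absorbed by an error 3ε(1 + Z_h)^b (`Config.partitionSum_succ_le`). Hence Z_n ≤
2n + 1 as soon as n^{b-1} times the sum of the ε is small, which is where α > b + 1 enters. The
union bound is at most ε_n Z_n (`Config.sum_exp_neg_energy_le`), which then tends to 0.

Disconnected regime: a second moment argument for the number of isolated subtrees of height h, where
b^h lies between n and bn. Their cut rate exceeds the capacity by a relative error of order 1/n at
most, so their expected number is at least of order n^{γ-1} with γ = β * capacity > 1. Two such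
subtrees interact at rate at most 3/4 of the capacity (`rate_block_and_le`), and the interactions of
one subtree sum to at most its own cut rate (`sum_rate_block_and_le`), so the variance is negligible
(`law_connected_le`). -/

noncomputable section

namespace ParticleModel

/-! ### Configurations on the leaves of a tree -/

/-- The subsets of the leaves of the `b`-ary tree of height `h`, as a recursive type. -/
inductive Config (b : ℕ) : ℕ → Type
  | leaf (p : Bool) : Config b 0
  | node {h : ℕ} (c : Fin b → Config b h) : Config b (h + 1)

namespace Config

variable {b : ℕ}

/-- A configuration of height `0` is the state of its leaf. -/
def leafEquiv (b : ℕ) : Bool ≃ Config b 0 where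
  toFun := leaf
  invFun | leaf p => p
  left_inv _ := rfl
  right_inv | leaf _ => rfl

/-- A configuration of positive height is the family of its restrictions to the subtrees. -/
def nodeEquiv (b h : ℕ) : (Fin b → Config b h) ≃ Config b (h + 1) where
  toFun := node
  invFun | node c => c
  left_inv _ := rfl
  right_inv | node _ => rfl

instance instFintype (b : ℕ) : ∀ h, Fintype (Config b h)
  | 0 => Fintype.ofEquiv _ (leafEquiv b)
  | h + 1 =>
    haveI := instFintype b h
    Fintype.ofEquiv _ (nodeEquiv b h)

/-- The complementary configuration. -/
def compl : ∀ {h : ℕ}, Config b h → Config b h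
  | _, leaf p => leaf (!p)
  | _, node c => node fun a => compl (c a)

/-- The proportion of occupied leaves. -/
def density : ∀ {h : ℕ}, Config b h → ℝ
  | _, leaf p => if p then 1 else 0
  | _, node c => (∑ a, density (c a)) / b

/-- The normalised energy of a configuration in an otherwise empty infinite tree. -/
def energy : ∀ {h : ℕ}, Config b h → ℝ
  | _, leaf p => if p then 1 else 0
  | _, node c =>
    ∑ a, energy (c a) - ((∑ a, density (c a)) ^ 2 - ∑ a, density (c a) ^ 2) / b

theorem density_node {h : ℕ} (c : Fin b → Config b h) :
    density (node c) = (∑ a, density (c a)) / b := rfl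

theorem energy_node {h : ℕ} (c : Fin b → Config b h) :
    energy (node c) =
      ∑ a, energy (c a) - ((∑ a, density (c a)) ^ 2 - ∑ a, density (c a) ^ 2) / b := rfl

theorem compl_compl : ∀ {h : ℕ} (c : Config b h), c.compl.compl = c
  | _, leaf p => by simp [compl]
  | _, node c => congrArg node (funext fun a => compl_compl (c a))

/-- Complementation as a permutation. -/
def complEquiv (b h : ℕ) : Config b h ≃ Config b h where
  toFun := compl
  invFun := compl
  left_inv := compl_compl
  right_inv := compl_compl

theorem density_nonneg : ∀ {h : ℕ} (c : Config b h), 0 ≤ c.density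
  | _, leaf p => by cases p <;> simp [density]
  | _, node c => by
    rw [density_node]
    exact div_nonneg (Finset.sum_nonneg fun a _ => density_nonneg (c a)) (Nat.cast_nonneg b)

theorem density_compl (hb : b ≠ 0) : ∀ {h : ℕ} (c : Config b h), c.compl.density = 1 - c.density
  | _, leaf p => by cases p <;> simp [density, compl]
  | _, node c => by
    have hb' : (b : ℝ) ≠ 0 := Nat.cast_ne_zero.2 hb
    have : density (compl (node c)) =
        (∑ a, (1 - density (c a))) / b := by
      rw [← Finset.sum_congr rfl fun a _ => density_compl hb (c a)]; rfl
    rw [this, density_node, Finset.sum_sub_distrib]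
    simp only [Finset.sum_const, Finset.card_univ, Fintype.card_fin, nsmul_eq_mul, mul_one]
    field_simp

theorem density_le_one (hb : b ≠ 0) {h : ℕ} (c : Config b h) : c.density ≤ 1 := by
  have := density_nonneg c.compl
  rw [density_compl hb] at this
  linarith

/-- Equivalently, `energy - density ^ 2` is invariant under complementation. This allows a dense
configuration to be compared with its sparse complement. -/
theorem energy_compl (hb : b ≠ 0) :
    ∀ {h : ℕ} (c : Config b h), c.compl.energy = c.energy + 1 - 2 * c.density
  | _, leaf p => by cases p <;> norm_num [density, energy, compl]
  | _, node c => by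
    have hb' : (b : ℝ) ≠ 0 := Nat.cast_ne_zero.2 hb
    have h1 : energy (compl (node c)) =
        ∑ a, energy (compl (c a)) - ((∑ a, density (compl (c a))) ^ 2 -
          ∑ a, density (compl (c a)) ^ 2) / b := rfl
    have h2 : ∀ x : ℝ, (1 - x) ^ 2 = 1 - 2 * x + x ^ 2 := fun x => by ring
    rw [h1, energy_node, density_node]
    simp_rw [energy_compl hb, density_compl hb, h2, Finset.sum_add_distrib,
      Finset.sum_sub_distrib, Finset.sum_add_distrib, ← Finset.mul_sum]
    simp only [Finset.sum_const, Finset.card_univ, Fintype.card_fin, nsmul_eq_mul, mul_one]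
    field_simp
    ring

/-- One occupied leaf already has density b^{-h}. This discreteness produces the factor b^h in
`errorTerm`. -/
theorem density_eq_zero_or_le (hb : b ≠ 0) :
    ∀ {h : ℕ} (c : Config b h), c.density = 0 ∨ ((b : ℝ) ^ h)⁻¹ ≤ c.density
  | _, leaf p => by cases p <;> simp [density]
  | _, node c => by
    have hb' : (0 : ℝ) < b := Nat.cast_pos.2 (Nat.pos_of_ne_zero hb)
    rw [density_node]
    by_cases hz : ∀ a, density (c a) = 0
    · left; simp [hz]
    · right
      push Not at hz
      obtain ⟨a, ha⟩ := hz
      have h1 := (density_eq_zero_or_le hb (c a)).resolve_left ha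
      rw [pow_succ, mul_inv, div_eq_mul_inv]
      gcongr
      exact h1.trans (Finset.single_le_sum (f := fun a => density (c a))
        (fun a _ => density_nonneg (c a)) (Finset.mem_univ a))

theorem eq_of_density_eq_zero (hb : b ≠ 0) : ∀ {h : ℕ} {c c' : Config b h},
    c.density = 0 → c'.density = 0 → c = c'
  | _, leaf p, leaf p', h1, h2 => by
    cases p <;> cases p' <;> simp_all [density]
  | _, @node _ h c, node c', h1, h2 => by
    have key : ∀ d : Fin b → Config b h, density (node d) = 0 → ∀ a, density (d a) = 0 := by
      intro d hd a
      rw [density_node, div_eq_zero_iff, or_iff_left (Nat.cast_ne_zero.2 hb),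
        Finset.sum_eq_zero_iff_of_nonneg fun a _ => density_nonneg _] at hd
      exact hd a (Finset.mem_univ a)
    exact congrArg node <| funext fun a => eq_of_density_eq_zero hb (key c h1 a) (key c' h2 a)

theorem energy_eq_zero (hb : b ≠ 0) : ∀ {h : ℕ} {c : Config b h}, c.density = 0 → c.energy = 0
  | _, leaf p, hc => hc
  | _, node c, hc => by
    rw [density_node, div_eq_zero_iff, or_iff_left (Nat.cast_ne_zero.2 hb),
      Finset.sum_eq_zero_iff_of_nonneg fun a _ => density_nonneg _] at hc
    have h0 : ∀ a, density (c a) = 0 := fun a => hc a (Finset.mem_univ a)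
    rw [energy_node]
    simp [h0, fun a => energy_eq_zero hb (h0 a)]

theorem sq_sum_sub_sum_sq {ι : Type*} [DecidableEq ι] (s : Finset ι) (x : ι → ℝ) :
    (∑ i ∈ s, x i) ^ 2 - ∑ i ∈ s, x i ^ 2 = ∑ i ∈ s, x i * (∑ j ∈ s, x j - x i) := by
  simp_rw [mul_sub, Finset.sum_sub_distrib, ← Finset.sum_mul, sq]

/-- The children of the root below which some leaf is occupied. -/
def support {h : ℕ} (c : Fin b → Config b h) : Finset (Fin b) :=
  Finset.univ.filter fun a => density (c a) ≠ 0

theorem mem_support {h : ℕ} {c : Fin b → Config b h} {a : Fin b} :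
    a ∈ support c ↔ density (c a) ≠ 0 := by simp [support]

theorem sum_support {h : ℕ} (c : Fin b → Config b h) {f : Fin b → ℝ}
    (hf : ∀ a, density (c a) = 0 → f a = 0) : ∑ a, f a = ∑ a ∈ support c, f a :=
  (Finset.sum_subset (Finset.subset_univ _) fun a _ ha =>
    hf a (not_not.1 fun h => ha (mem_support.2 h))).symm

theorem sum_density_support {h : ℕ} (c : Fin b → Config b h) :
    ∑ a, density (c a) = ∑ a ∈ support c, density (c a) :=
  sum_support c fun _ h => h

theorem energy_support (hb : b ≠ 0) {h : ℕ} (c : Fin b → Config b h) :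
    energy (node c) = ∑ a ∈ support c, energy (c a) -
      (∑ a ∈ support c, density (c a) * (∑ a ∈ support c, density (c a) - density (c a))) / b := by
  rw [energy_node, ← sq_sum_sub_sum_sq, sum_density_support,
    sum_support c fun a => energy_eq_zero hb,
    sum_support c (f := fun a => density (c a) ^ 2) fun a ha => by rw [ha]; norm_num]

/-- If m branches are occupied, they contribute at least m by induction, and since densities are at
most 1 and m ≤ b, the interactions remove at most m(m - 1)/b ≤ m - 1. -/
theorem one_le_energy (hb : b ≠ 0) : ∀ {h : ℕ} {c : Config b h}, c.density ≠ 0 → 1 ≤ c.energy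
  | _, leaf p, hc => by cases p <;> simp_all [density, energy]
  | _, node c, hc => by
    have hb' : (0 : ℝ) < b := Nat.cast_pos.2 (Nat.pos_of_ne_zero hb)
    rw [energy_support hb]
    set J := support (b := b) c with hJ
    have hne : J.Nonempty := by
      by_contra hJe
      rw [Finset.not_nonempty_iff_eq_empty] at hJe
      rw [density_node, sum_density_support, ← hJ, hJe] at hc
      simp at hc
    have hcard : (1 : ℝ) ≤ J.card := by exact_mod_cast hne.card_pos
    have hcb : (J.card : ℝ) ≤ b := by
      have := Finset.card_le_univ J
      rw [Fintype.card_fin] at this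
      exact_mod_cast this
    have h1 : (J.card : ℝ) ≤ ∑ a ∈ J, energy (c a) := by
      have := Finset.card_nsmul_le_sum J (fun a => energy (c a)) 1
        fun a ha => one_le_energy hb (mem_support.1 ha)
      simpa using this
    have h2 : ∑ a ∈ J, density (c a) * (∑ a ∈ J, density (c a) - density (c a)) ≤
        J.card * (J.card - 1) := by
      rw [← nsmul_eq_mul]
      refine Finset.sum_le_card_nsmul _ _ _ fun a ha => ?_
      have h3 : ∑ a ∈ J, density (c a) - density (c a) ≤ J.card - 1 := by
        rw [← Finset.add_sum_erase J _ ha, add_sub_cancel_left]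
        have := Finset.sum_le_card_nsmul (J.erase a) (fun a => density (c a)) 1
          fun a _ => density_le_one hb _
        rw [Finset.card_erase_of_mem ha, nsmul_one, Nat.cast_pred hne.card_pos] at this
        exact this
      have h4 := density_le_one hb (c a)
      have h5 := density_nonneg (c a)
      nlinarith
    have h6 : (∑ a ∈ J, density (c a) * (∑ a ∈ J, density (c a) - density (c a))) / b ≤
        J.card - 1 := by
      rw [div_le_iff₀ hb']
      nlinarith
    linarith

end Config

/-! ### Gibbs weights and the recursion for the partition sum -/

namespace Config

variable {b : ℕ}

/-- A bound for the relative weight of an additional small piece of a configuration. -/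
def errorTerm (b : ℕ) (L : ℝ) (h : ℕ) : ℝ :=
  Real.exp 2 * b ^ h * Real.exp (-L) + L * Real.exp (-(L / 4))

/-- The Gibbs weight of a configuration, biased by its density. -/
def weight (L : ℝ) {h : ℕ} (c : Config b h) : ℝ :=
  c.density * Real.exp (-(L * (c.energy - 1)))

/-- The sum of the weights of all configurations. -/
def partitionSum (b : ℕ) (L : ℝ) (h : ℕ) : ℝ := ∑ c : Config b h, weight L c

theorem errorTerm_nonneg {L : ℝ} (hL : 0 ≤ L) (h : ℕ) : 0 ≤ errorTerm b L h := by
  unfold errorTerm; positivity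

theorem errorTerm_mono (hb : b ≠ 0) {L : ℝ} : Monotone (errorTerm b L) := fun h k hk => by
  unfold errorTerm
  have : (1 : ℝ) ≤ b := by exact_mod_cast Nat.one_le_iff_ne_zero.2 hb
  gcongr

theorem weight_nonneg (L : ℝ) {h : ℕ} (c : Config b h) : 0 ≤ weight L c :=
  mul_nonneg (density_nonneg c) (Real.exp_pos _).le

theorem weight_eq_zero {L : ℝ} {h : ℕ} {c : Config b h} (hc : c.density = 0) : weight L c = 0 := by
  rw [weight, hc, zero_mul]

theorem partitionSum_nonneg (L : ℝ) (h : ℕ) : 0 ≤ partitionSum b L h :=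
  Finset.sum_nonneg fun c _ => weight_nonneg L c

/-- The two summands of `errorTerm` answer two cases. If Lx ≤ 1 then Ly ≤ 2, and 1 ≤ b^h x supplies
the factor x; if Lx ≥ 1 then y ≤ 3/4 leaves e^{-L/4}, and Lx supplies it. Here x is the density of a
small piece, and the bound returns that density as a factor of a new weight. -/
theorem exp_neg_mul_le_errorTerm (hb : b ≠ 0) {L x y : ℝ} {h : ℕ} (hL : 0 ≤ L)
    (hx : ((b : ℝ) ^ h)⁻¹ ≤ x) (hyx : y ≤ 2 * x) (hy : y ≤ 3 / 4) :
    Real.exp (-(L * (1 - y))) ≤ errorTerm b L h * x := by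
  have hb' : (0 : ℝ) < b := Nat.cast_pos.2 (Nat.pos_of_ne_zero hb)
  have hbh : (0 : ℝ) < (b : ℝ) ^ h := by positivity
  have hx0 : 0 < x := (inv_pos.2 hbh).trans_le hx
  have h1 : 1 ≤ (b : ℝ) ^ h * x := by
    have := mul_le_mul_of_nonneg_left hx hbh.le
    rwa [mul_inv_cancel₀ hbh.ne'] at this
  rw [errorTerm, add_mul]
  rcases le_total (L * x) 1 with hLx | hLx
  · have h2 : Real.exp (-(L * (1 - y))) ≤ Real.exp 2 * Real.exp (-L) := by
      rw [← Real.exp_add]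
      apply Real.exp_le_exp.2
      nlinarith
    have h3 : Real.exp 2 * Real.exp (-L) ≤ Real.exp 2 * b ^ h * Real.exp (-L) * x := by
      have : 0 ≤ Real.exp 2 * Real.exp (-L) := by positivity
      nlinarith
    have : 0 ≤ L * Real.exp (-(L / 4)) * x := by positivity
    linarith
  · have h2 : Real.exp (-(L * (1 - y))) ≤ Real.exp (-(L / 4)) := by
      apply Real.exp_le_exp.2
      nlinarith
    have h3 : Real.exp (-(L / 4)) ≤ L * Real.exp (-(L / 4)) * x := by
      have := Real.exp_pos (-(L / 4))
      nlinarith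
    have : 0 ≤ Real.exp 2 * b ^ h * Real.exp (-L) * x := by positivity
    linarith

theorem sum_ite_density_eq_zero_le (hb : b ≠ 0) (h : ℕ) :
    ∑ c : Config b h, (if c.density = 0 then (1 : ℝ) else 0) ≤ 1 := by
  classical
  rw [Finset.sum_boole]
  have : (Finset.univ.filter fun c : Config b h => c.density = 0).card ≤ 1 :=
    Finset.card_le_one.2 fun c hc d hd =>
      eq_of_density_eq_zero hb (Finset.mem_filter.1 hc).2 (Finset.mem_filter.1 hd).2
  exact_mod_cast this

/-- The sum of the weights of the configurations that are not too dense. -/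
def sparseSum (b : ℕ) (L : ℝ) (h : ℕ) : ℝ :=
  ∑ c : Config b h, if c.density ≤ 3 / 4 then weight L c else 0

/-- The full configuration accounts for the 1. Any other configuration of density above 3/4 weighs
at most ε times its complement, which is sparse, and complementation is a bijection. -/
theorem partitionSum_le_sparseSum (hb : b ≠ 0) {L : ℝ} (hL : 0 ≤ L) (h : ℕ) :
    partitionSum b L h ≤ 1 + (1 + errorTerm b L h) * sparseSum b L h := by
  have hε := errorTerm_nonneg (b := b) hL h
  have key : ∀ c : Config b h, weight L c ≤ (if c.compl.density = 0 then (1 : ℝ) else 0) +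
      ((if c.density ≤ 3 / 4 then weight L c else 0) +
        errorTerm b L h * (if c.compl.density ≤ 3 / 4 then weight L c.compl else 0)) := by
    intro c
    have hw : 0 ≤ (if c.compl.density ≤ 3 / 4 then weight L c.compl else 0) := by
      split_ifs
      exacts [weight_nonneg _ _, le_rfl]
    have hw' : 0 ≤ (if c.compl.density = 0 then (1 : ℝ) else 0) := by
      split_ifs <;> norm_num
    have hw'' := mul_nonneg hε hw
    have hd := density_compl hb c
    have he := energy_compl hb c
    have hd1 := density_le_one hb c
    by_cases h1 : c.density ≤ 3 / 4
    · rw [if_pos h1]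
      linarith
    · rw [if_neg h1]
      by_cases h2 : c.compl.density = 0
      · rw [if_pos h2]
        have h3 : weight L c ≤ 1 := by
          have he0 := energy_eq_zero hb h2
          rw [weight, show c.energy - 1 = 0 by linarith]
          simpa using hd1
        linarith
      · rw [if_neg h2]
        have h3 : c.compl.density ≤ 3 / 4 := by push Not at h1; linarith
        rw [if_pos h3, weight, weight]
        have h4 := exp_neg_mul_le_errorTerm hb (x := c.compl.density)
          (y := 2 * c.compl.density) hL
          ((density_eq_zero_or_le hb c.compl).resolve_left h2) le_rfl
          (by push Not at h1; linarith)
        have h5 : Real.exp (-(L * (c.energy - 1))) =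
            Real.exp (-(L * (c.compl.energy - 1))) *
              Real.exp (-(L * (1 - 2 * c.compl.density))) := by
          rw [← Real.exp_add]; congr 1; rw [he, hd]; ring
        have h6 := (Real.exp_pos (-(L * (c.energy - 1)))).le
        calc c.density * Real.exp (-(L * (c.energy - 1)))
            ≤ Real.exp (-(L * (c.energy - 1))) := by nlinarith
          _ ≤ Real.exp (-(L * (c.compl.energy - 1))) *
              (errorTerm b L h * c.compl.density) := by rw [h5]; gcongr
          _ = _ := by ring
  refine (Finset.sum_le_sum fun c _ => key c).trans ?_
  rw [Finset.sum_add_distrib, Finset.sum_add_distrib, ← Finset.mul_sum]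
  have e1 := (complEquiv b h).sum_comp fun c => if c.density = 0 then (1 : ℝ) else 0
  have e2 := (complEquiv b h).sum_comp fun c => if c.density ≤ 3 / 4 then weight L c else 0
  change ∑ c : Config b h, (if c.compl.density = 0 then (1 : ℝ) else 0) = _ at e1
  change ∑ c : Config b h, (if c.compl.density ≤ 3 / 4 then weight L c.compl else 0) = _ at e2
  rw [e1, e2]
  have := sum_ite_density_eq_zero_le hb h
  unfold sparseSum
  linarith

/-- The weight of a configuration with several occupied branches. -/
theorem weight_node_le (hb : b ≠ 0) {L : ℝ} (hL : 0 ≤ L) {h : ℕ} (hε : errorTerm b L h ≤ 1)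
    {c : Fin b → Config b h} (hc : density (node c) ≤ 3 / 4) (hJ : 2 ≤ (support c).card) :
    weight L (node c) ≤
      errorTerm b L h * ∏ a ∈ support c, weight L (c a) := by
  have hb0 : (0 : ℝ) < b := Nat.cast_pos.2 (Nat.pos_of_ne_zero hb)
  have hε0 := errorTerm_nonneg (b := b) hL h
  obtain ⟨k, hk, hmax⟩ := Finset.exists_max_image (support c) (fun a => density (c a))
    (Finset.card_pos.1 (by lia))
  have hb2 : (2 : ℝ) ≤ b := by
    have := hJ.trans (Finset.card_le_univ _)
    rw [Fintype.card_fin] at this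
    exact_mod_cast this
  set J := support c with hJdef
  set s := ∑ a ∈ J, density (c a) with hs
  -- The densest branch `k` serves as the base. The interactions of `k` with the others are charged
  -- to the others, so each further branch `a` costs the factor exp(-L(1 - y a)), which is at most ε
  -- times its density.
  set y : Fin b → ℝ := fun a => density (c a) * (s + density (c k) - density (c a)) / b with hy
  have hsb : s ≤ 3 / 4 * b := by
    rw [density_node, sum_density_support, div_le_iff₀ hb0] at hc
    exact hc
  have hsk : s ≤ b * density (c k) := by
    have := Finset.sum_le_card_nsmul J (fun a => density (c a)) (density (c k)) hmax
    rw [nsmul_eq_mul] at this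
    refine this.trans (mul_le_mul_of_nonneg_right ?_ (density_nonneg _))
    have := Finset.card_le_univ J
    rw [Fintype.card_fin] at this
    exact_mod_cast this
  have hquad : ∑ a ∈ J, density (c a) * (s - density (c a)) =
      ∑ a ∈ J.erase k, density (c a) * (s + density (c k) - density (c a)) := by
    rw [← Finset.add_sum_erase J _ hk]
    have : s - density (c k) = ∑ a ∈ J.erase k, density (c a) := by
      rw [hs, ← Finset.add_sum_erase J _ hk, add_sub_cancel_left]
    rw [this, Finset.mul_sum, ← Finset.sum_add_distrib]
    exact Finset.sum_congr rfl fun a _ => by ring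
  have henergy : energy (node c) - 1 =
      ∑ a ∈ J, (energy (c a) - 1) + ∑ a ∈ J.erase k, (1 - y a) := by
    rw [energy_support hb, ← hJdef, ← hs, hquad, Finset.sum_sub_distrib, Finset.sum_sub_distrib,
      Finset.sum_div]
    simp only [Finset.sum_const, nsmul_eq_mul, mul_one, Finset.card_erase_of_mem hk]
    rw [Nat.cast_pred (by lia)]
    ring
  have hy1 : ∀ a ∈ J.erase k, Real.exp (-(L * (1 - y a))) ≤ errorTerm b L h * density (c a) := by
    intro a ha
    have haJ := Finset.mem_of_mem_erase ha
    have hd0 := density_nonneg (c a)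
    have hd1 := density_le_one hb (c a)
    have hk1 := density_le_one hb (c k)
    refine exp_neg_mul_le_errorTerm hb hL
      ((density_eq_zero_or_le hb (c a)).resolve_left (mem_support.1 haJ)) ?_ ?_
    · rw [hy, div_le_iff₀ hb0]
      nlinarith
    · rw [hy, div_le_iff₀ hb0]
      have h1 : density (c a) * (1 - density (c a)) ≤
          density (c a) * (1 - density (c a)) * (b / 2) :=
        le_mul_of_one_le_right (mul_nonneg hd0 (by linarith)) (by linarith)
      have h2 : density (c a) * (s + density (c k) - density (c a)) ≤
          density (c a) * (3 / 4 * b) + density (c a) * (1 - density (c a)) * (b / 2) := by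
        nlinarith
      have h3 : 0 ≤ (1 - density (c a)) * (3 / 4 - density (c a) / 2) * b := by
        apply mul_nonneg (mul_nonneg _ _) hb0.le <;> linarith
      nlinarith
  have hexp : Real.exp (-(L * (energy (node c) - 1))) =
      (∏ a ∈ J, Real.exp (-(L * (energy (c a) - 1)))) *
        ∏ a ∈ J.erase k, Real.exp (-(L * (1 - y a))) := by
    rw [henergy, ← Real.exp_sum, ← Real.exp_sum, ← Real.exp_add, Finset.sum_neg_distrib,
      Finset.sum_neg_distrib, ← Finset.mul_sum, ← Finset.mul_sum]
    congr 1
    ring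
  have hprod : ∏ a ∈ J.erase k, Real.exp (-(L * (1 - y a))) ≤
      errorTerm b L h * ∏ a ∈ J.erase k, density (c a) := by
    refine (Finset.prod_le_prod (fun a _ => (Real.exp_pos _).le) hy1).trans ?_
    rw [Finset.prod_mul_distrib, Finset.prod_const]
    refine mul_le_mul_of_nonneg_right ?_ (Finset.prod_nonneg fun a _ => density_nonneg _)
    exact pow_le_of_le_one hε0 hε (by rw [Finset.card_erase_of_mem hk]; lia)
  have hdens : density (node c) ≤ density (c k) := by
    rw [density_node, sum_density_support, div_le_iff₀ hb0, mul_comm]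
    exact hsk
  have hP : 0 ≤ ∏ a ∈ J, Real.exp (-(L * (energy (c a) - 1))) :=
    Finset.prod_nonneg fun a _ => (Real.exp_pos _).le
  calc weight L (node c)
      ≤ density (c k) * ((∏ a ∈ J, Real.exp (-(L * (energy (c a) - 1)))) *
        (errorTerm b L h * ∏ a ∈ J.erase k, density (c a))) := by
        rw [weight, hexp]
        refine mul_le_mul hdens (mul_le_mul_of_nonneg_left hprod hP) ?_ (density_nonneg _)
        exact mul_nonneg hP (Finset.prod_nonneg fun a _ => (Real.exp_pos _).le)
    _ = errorTerm b L h * ∏ a ∈ J, weight L (c a) := by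
        simp only [weight]
        rw [Finset.prod_mul_distrib, ← Finset.mul_prod_erase J (fun a => density (c a)) hk]
        ring

/-- The weight of a configuration with a single occupied branch. -/
theorem weight_node_single (hb : b ≠ 0) (L : ℝ) {h : ℕ} {c : Fin b → Config b h} {k : Fin b}
    (hk : support c = {k}) : weight L (node c) = weight L (c k) / b := by
  rw [weight, energy_support hb, density_node, sum_density_support, hk]
  simp [weight]
  ring

/-- With one occupied branch the b positions compensate the division of the density by b, giving
Z_h. With two or more, `weight_node_le` gains a factor ε over the product of the weights of the
branches, each of which is empty or weighted. -/
theorem sparseSum_succ_le (hb : b ≠ 0) {L : ℝ} (hL : 0 ≤ L) {h : ℕ} (hε : errorTerm b L h ≤ 1) :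
    sparseSum b L (h + 1) ≤
      partitionSum b L h + errorTerm b L h * (1 + partitionSum b L h) ^ b := by
  classical
  have hb0 : (0 : ℝ) < b := Nat.cast_pos.2 (Nat.pos_of_ne_zero hb)
  have hε0 := errorTerm_nonneg (b := b) hL h
  set empty : Config b h → ℝ := fun c => if c.density = 0 then 1 else 0 with hempty
  have hempty0 : ∀ c, 0 ≤ empty c := fun c => by rw [hempty]; dsimp only; split_ifs <;> norm_num
  have hsum := sum_ite_density_eq_zero_le hb h
  change ∑ c, empty c ≤ 1 at hsum
  have key : ∀ c : Fin b → Config b h,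
      (if density (node c) ≤ 3 / 4 then weight L (node c) else 0) ≤
        ∑ k, (∏ a, if a = k then weight L (c a) else empty (c a)) / b +
          errorTerm b L h * ∏ a, (empty (c a) + weight L (c a)) := by
    intro c
    have h1 : 0 ≤ ∏ a, (empty (c a) + weight L (c a)) :=
      Finset.prod_nonneg fun a _ => add_nonneg (hempty0 _) (weight_nonneg _ _)
    have h2 : ∀ k, 0 ≤ (∏ a, if a = k then weight L (c a) else empty (c a)) / (b : ℝ) :=
      fun k => div_nonneg (Finset.prod_nonneg fun a _ => by
        split_ifs
        exacts [weight_nonneg _ _, hempty0 _]) hb0.le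
    have h3 := Finset.sum_nonneg fun k (_ : k ∈ Finset.univ) => h2 k
    have h4 := mul_nonneg hε0 h1
    split_ifs with hc
    · rcases lt_or_ge (support c).card 2 with hJ | hJ
      · rcases Nat.lt_succ_iff_lt_or_eq.1 hJ with hJ | hJ
        · have : density (node c) = 0 := by
            rw [density_node, sum_density_support, Finset.card_eq_zero.1 (Nat.lt_one_iff.1 hJ)]
            simp
          rw [weight_eq_zero this]
          linarith
        · obtain ⟨k, hk⟩ := Finset.card_eq_one.1 hJ
          have h5 := Finset.single_le_sum (fun k _ => h2 k) (Finset.mem_univ k)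
          have h6 : (∏ a, if a = k then weight L (c a) else empty (c a)) = weight L (c k) := by
            rw [Finset.prod_eq_single k]
            · simp
            · intro a _ ha
              rw [if_neg ha, hempty]
              refine if_pos (not_not.1 fun h => ha ?_)
              have := mem_support.2 h
              rwa [hk, Finset.mem_singleton] at this
            · simp
          rw [weight_node_single hb L hk, ← h6]
          linarith
      · have h5 := weight_node_le hb hL hε hc hJ
        have h6 : ∏ a ∈ support c, weight L (c a) = ∏ a, (empty (c a) + weight L (c a)) := by
          symm
          rw [← Finset.prod_subset (Finset.subset_univ (support c))]
          · refine Finset.prod_congr rfl fun a ha => ?_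
            rw [hempty]
            dsimp only
            rw [if_neg (mem_support.1 ha), zero_add]
          · intro a _ ha
            have : density (c a) = 0 := not_not.1 fun h => ha (mem_support.2 h)
            rw [weight_eq_zero this, hempty]
            simp [this]
        rw [← h6]
        linarith
    · linarith
  have hS : sparseSum b L (h + 1) =
      ∑ c : Fin b → Config b h, if density (node c) ≤ 3 / 4 then weight L (node c) else 0 :=
    ((nodeEquiv b h).sum_comp fun c => if density c ≤ 3 / 4 then weight L c else 0).symm
  rw [hS]
  refine (Finset.sum_le_sum fun c _ => key c).trans ?_
  rw [Finset.sum_add_distrib, ← Finset.mul_sum, Finset.sum_comm]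
  refine add_le_add ?_ (mul_le_mul_of_nonneg_left ?_ hε0)
  · have : ∀ k : Fin b, ∑ c : Fin b → Config b h,
        (∏ a, if a = k then weight L (c a) else empty (c a)) / (b : ℝ) ≤
          partitionSum b L h / b := by
      intro k
      rw [← Finset.sum_div]
      refine div_le_div_of_nonneg_right ?_ hb0.le
      -- The branches are chosen independently, so the sum factorises; every branch other than `k`
      -- contributes at most 1, from the empty configuration.
      have := Finset.prod_univ_sum (fun _ : Fin b => (Finset.univ : Finset (Config b h)))
        fun a c => if a = k then weight L c else empty c
      rw [Fintype.piFinset_univ] at this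
      rw [← this, ← Finset.mul_prod_erase _ _ (Finset.mem_univ k)]
      have h1 : ∏ a ∈ Finset.univ.erase k,
          ∑ c, (if a = k then weight L c else empty c) ≤ 1 := by
        refine Finset.prod_le_one (fun a ha => Finset.sum_nonneg fun c _ => ?_) fun a ha => ?_
        · split_ifs
          exacts [weight_nonneg _ _, hempty0 _]
        · simpa [Finset.ne_of_mem_erase ha] using hsum
      simp only [if_true]
      exact mul_le_of_le_one_right (partitionSum_nonneg L h) h1
    refine (Finset.sum_le_sum fun k _ => this k).trans ?_
    simp only [Finset.sum_const, Finset.card_univ, Fintype.card_fin, nsmul_eq_mul]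
    rw [mul_div_cancel₀ _ hb0.ne']
  · have := Finset.prod_univ_sum (fun _ : Fin b => (Finset.univ : Finset (Config b h)))
      fun _ c => empty c + weight L c
    rw [Fintype.piFinset_univ] at this
    rw [← this, Finset.prod_const, Finset.card_univ, Fintype.card_fin, Finset.sum_add_distrib]
    refine pow_le_pow_left₀ ?_ (add_le_add_left hsum _) b
    exact add_nonneg (Finset.sum_nonneg fun c _ => hempty0 c) (partitionSum_nonneg L h)

theorem partitionSum_zero (L : ℝ) : partitionSum b L 0 = 1 := by
  rw [partitionSum, ← (leafEquiv b).sum_comp]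
  simp [leafEquiv, weight, density, energy]

theorem partitionSum_succ_le (hb : b ≠ 0) {L : ℝ} (hL : 0 ≤ L) {h : ℕ}
    (hε : errorTerm b L (h + 1) ≤ 1) :
    partitionSum b L (h + 1) ≤
      1 + partitionSum b L h + 3 * errorTerm b L (h + 1) * (1 + partitionSum b L h) ^ b := by
  have hmono := errorTerm_mono hb (L := L) (Nat.le_succ h)
  have h0 := errorTerm_nonneg (b := b) hL h
  have h1 := errorTerm_nonneg (b := b) hL (h + 1)
  have hZ := partitionSum_nonneg (b := b) L h
  have hpow : partitionSum b L h ≤ (1 + partitionSum b L h) ^ b := by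
    refine (le_add_of_nonneg_left zero_le_one).trans (le_self_pow₀ ?_ hb)
    linarith
  have hpow0 := hZ.trans hpow
  have h2 := partitionSum_le_sparseSum hb hL (h + 1)
  have h3 := sparseSum_succ_le hb hL (hmono.trans hε)
  set ε := errorTerm b L (h + 1)
  set ε' := errorTerm b L h
  set Z := partitionSum b L h
  set P := (1 + Z) ^ b
  have h4 : (1 + ε) * sparseSum b L (h + 1) ≤ (1 + ε) * (Z + ε * P) := by
    refine mul_le_mul_of_nonneg_left (h3.trans ?_) (by linarith)
    gcongr
  have h5 : ε * Z ≤ ε * P := mul_le_mul_of_nonneg_left hpow h1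
  have h6 : ε * (ε * P) ≤ 1 * (ε * P) := mul_le_mul_of_nonneg_right hε (by positivity)
  nlinarith

/-- A bootstrap: while the partition sum stays below 2n + 1, each error is at most 3(2n + 2)^b ε,
and by `hsum` all errors together stay below n. The induction carries the partial sums of the
errors. -/
theorem partitionSum_le (hb : b ≠ 0) {L : ℝ} (hL : 0 ≤ L) {n : ℕ} (hε : errorTerm b L n ≤ 1)
    (hsum : 3 * (2 * n + 2 : ℝ) ^ b * ∑ k ∈ Finset.range (n + 1), errorTerm b L k ≤ n) :
    partitionSum b L n ≤ 2 * n + 1 := by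
  have key : ∀ h ≤ n, partitionSum b L h ≤
      1 + h + 3 * (2 * n + 2 : ℝ) ^ b * ∑ k ∈ Finset.range (h + 1), errorTerm b L k := by
    intro h
    induction h with
    | zero =>
      intro _
      rw [partitionSum_zero]
      have := Finset.sum_nonneg fun k (_ : k ∈ Finset.range (0 + 1)) =>
        errorTerm_nonneg (b := b) hL k
      have : 0 ≤ 3 * (2 * n + 2 : ℝ) ^ b * ∑ k ∈ Finset.range (0 + 1), errorTerm b L k := by
        positivity
      push_cast
      linarith
    | succ h ih =>
      intro hn
      have h1 := ih (by lia)
      have h2 := partitionSum_succ_le hb hL ((errorTerm_mono hb hn).trans hε)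
      have h3 : ∑ k ∈ Finset.range (h + 1), errorTerm b L k ≤
          ∑ k ∈ Finset.range (n + 1), errorTerm b L k :=
        Finset.sum_le_sum_of_subset_of_nonneg (Finset.range_mono (by lia))
          fun k _ _ => errorTerm_nonneg hL k
      have h4 : (3 * (2 * n + 2 : ℝ) ^ b) * ∑ k ∈ Finset.range (h + 1), errorTerm b L k ≤
          (3 * (2 * n + 2 : ℝ) ^ b) * ∑ k ∈ Finset.range (n + 1), errorTerm b L k :=
        mul_le_mul_of_nonneg_left h3 (by positivity)
      have h5 : 1 + partitionSum b L h ≤ 2 * n + 2 := by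
        have : (h : ℝ) ≤ n := by exact_mod_cast (by lia : h ≤ n)
        linarith
      have h6 : (1 + partitionSum b L h) ^ b ≤ (2 * n + 2 : ℝ) ^ b :=
        pow_le_pow_left₀ (by linarith [partitionSum_nonneg (b := b) L h]) h5 b
      have h7 := mul_le_mul_of_nonneg_left h6
        (mul_nonneg zero_le_three (errorTerm_nonneg (b := b) hL (h + 1)))
      rw [Finset.sum_range_succ _ (h + 1), mul_add]
      push_cast
      linarith
  have := key n le_rfl
  linarith

/-- The union bound over all configurations of density at most `1 / 2`. -/
theorem sum_exp_neg_energy_le (hb : b ≠ 0) {L : ℝ} (hL : 0 ≤ L) (n : ℕ) :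
    ∑ c : Config b n, (if c.density ≠ 0 ∧ c.density ≤ 1 / 2 then
      Real.exp (-(L * (c.energy - c.density ^ 2))) else 0) ≤
        errorTerm b L n * partitionSum b L n := by
  rw [partitionSum, Finset.mul_sum]
  refine Finset.sum_le_sum fun c _ => ?_
  split_ifs with hc
  · have h0 := density_nonneg c
    -- Density at most 1/2 gives density² ≤ 1/4, within the admissible range for `y`.
    have h1 := exp_neg_mul_le_errorTerm hb (y := c.density ^ 2) hL
      ((density_eq_zero_or_le hb c).resolve_left hc.1) (by nlinarith) (by nlinarith)
    have h2 : Real.exp (-(L * (c.energy - c.density ^ 2))) =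
        Real.exp (-(L * (c.energy - 1))) * Real.exp (-(L * (1 - c.density ^ 2))) := by
      rw [← Real.exp_add]; congr 1; ring
    rw [h2, weight]
    calc _ ≤ Real.exp (-(L * (c.energy - 1))) * (errorTerm b L n * c.density) := by gcongr
      _ = _ := by ring
  · exact mul_nonneg (errorTerm_nonneg hL n) (weight_nonneg L c)

end Config

/-! ### Harmonic functions on the tree -/

section Harmonic

variable {b : ℕ}

/-- The sum of `f` over the leaves at height `h` below `w`. -/
def leafSum (f : List (Fin b) → ℝ) : ℕ → List (Fin b) → ℝ
  | 0, w => f w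
  | h + 1, w => ∑ a, leafSum f h (a :: w)

/-- The mean of `f` over the leaves at height `h` below `w`. -/
def leafMean (f : List (Fin b) → ℝ) : ℕ → List (Fin b) → ℝ
  | 0, w => f w
  | h + 1, w => (∑ a, leafMean f h (a :: w)) / b

/-- The probability that simple random walk started at height `h` steps up before it reaches the
leaves. -/
def upRatio (b h : ℕ) : ℝ := ((b : ℝ) ^ h - 1) / ((b : ℝ) ^ (h + 1) - 1)

/-- The Dirichlet energy, on the subtree of height `h` below `w`, of `f` on the leaves. -/
def leafEnergy (f : List (Fin b) → ℝ) : ℕ → List (Fin b) → ℝ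
  | 0, _ => 0
  | h + 1, w => ∑ a, leafEnergy f h (a :: w) +
      (1 - upRatio b h) * ∑ a, (leafMean f h (a :: w) - leafMean f (h + 1) w) ^ 2

/-- The harmonic extension to the tree of height `n` of a function on its leaves. -/
def harmonicExt (f : List (Fin b) → ℝ) (n : ℕ) : List (Fin b) → ℝ
  | [] => leafMean f n []
  | a :: w => upRatio b (n - (w.length + 1)) * harmonicExt f n w +
      (1 - upRatio b (n - (w.length + 1))) * leafMean f (n - (w.length + 1)) (a :: w)

theorem harmonicExt_cons (f : List (Fin b) → ℝ) {n h : ℕ} {w : List (Fin b)}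
    (hw : w.length + h + 1 = n) (a : Fin b) : harmonicExt f n (a :: w) =
      upRatio b h * harmonicExt f n w + (1 - upRatio b h) * leafMean f h (a :: w) := by
  rw [harmonicExt, show n - (w.length + 1) = h by lia]

theorem upRatio_zero (b : ℕ) : upRatio b 0 = 0 := by simp [upRatio]

theorem harmonicExt_leaf (f : List (Fin b) → ℝ) {n : ℕ} {w : List (Fin b)} (hw : w.length = n)
    : harmonicExt f n w = f w := by
  cases w with
  | nil => subst hw; rfl
  | cons a w =>
    rw [harmonicExt_cons f (h := 0) (by simpa using hw), upRatio_zero]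
    simp [leafMean]

theorem sum_leafMean (hb : b ≠ 0) (f : List (Fin b) → ℝ) (h : ℕ) (w : List (Fin b)) :
    ∑ a, leafMean f h (a :: w) = b * leafMean f (h + 1) w := by
  rw [leafMean, mul_div_cancel₀ _ (Nat.cast_ne_zero.2 hb)]

theorem sum_harmonicExt_cons (hb : b ≠ 0) (f : List (Fin b) → ℝ) {n h : ℕ} {w : List (Fin b)}
    (hw : w.length + h + 1 = n) : ∑ a, harmonicExt f n (a :: w) =
      b * (upRatio b h * harmonicExt f n w + (1 - upRatio b h) * leafMean f (h + 1) w) := by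
  simp_rw [harmonicExt_cons f hw, Finset.sum_add_distrib, ← Finset.mul_sum, sum_leafMean hb]
  simp
  ring

theorem harmonicExt_root (hb : b ≠ 0) (f : List (Fin b) → ℝ) {n : ℕ} (hn : n ≠ 0) :
    ∑ a, harmonicExt f n [a] = b * harmonicExt f n [] := by
  obtain ⟨h, rfl⟩ := Nat.exists_eq_succ_of_ne_zero hn
  rw [sum_harmonicExt_cons hb f (h := h) (by simp), harmonicExt]
  ring

/-- First-step analysis: from height h + 1 the walk moves up at once, or moves to one of b children,
must climb back, and then starts afresh. -/
theorem upRatio_mul_upRatio_succ (hb : 2 ≤ b) (h : ℕ) :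
    b * (upRatio b h * upRatio b (h + 1)) + 1 = (b + 1) * upRatio b (h + 1) := by
  have hb' : (2 : ℝ) ≤ b := by exact_mod_cast hb
  have hp : (1 : ℝ) ≤ (b : ℝ) ^ h := one_le_pow₀ (by linarith)
  have h1 : (b : ℝ) ^ (h + 1) - 1 ≠ 0 := by
    have : (1 : ℝ) < (b : ℝ) ^ (h + 1) := one_lt_pow₀ (by linarith) (by lia)
    linarith
  have h2 : (b : ℝ) ^ (h + 1 + 1) - 1 ≠ 0 := by
    have : (1 : ℝ) < (b : ℝ) ^ (h + 1 + 1) := one_lt_pow₀ (by linarith) (by lia)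
    linarith
  unfold upRatio
  rw [div_mul_div_cancel₀ h1]
  field_simp
  ring

/-- Every value involved is a combination of the parent's value and the leaf mean below the vertex;
the coefficient of their difference vanishes by the first-step identity for `upRatio`. -/
theorem harmonicExt_interior (hb : 2 ≤ b) (f : List (Fin b) → ℝ) {n : ℕ} {a : Fin b}
    {w : List (Fin b)} (hw : w.length + 1 < n) :
    ∑ a', harmonicExt f n (a' :: a :: w) + harmonicExt f n w =
      (b + 1) * harmonicExt f n (a :: w) := by
  obtain ⟨h, rfl⟩ := Nat.exists_eq_add_of_lt hw
  have h1 : w.length + 1 + h + 1 = w.length + (h + 1) + 1 := by lia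
  rw [sum_harmonicExt_cons (by lia) f (h := h) (by simp), h1,
    harmonicExt_cons f (h := h + 1) rfl]
  linear_combination (harmonicExt f (w.length + (h + 1) + 1) w - leafMean f (h + 1) (a :: w)) *
    upRatio_mul_upRatio_succ hb h

theorem sum_mul_sub_eq {ι : Type*} [Fintype ι] (m : ι → ℝ) {μ F r : ℝ}
    (hμ : ∑ i, m i = Fintype.card ι * μ) :
    ∑ i, m i * ((1 - r) * (m i - F)) =
      (1 - r) * ∑ i, (m i - μ) ^ 2 + μ * ∑ i, (1 - r) * (m i - F) := by
  have h1 : ∀ i, m i * ((1 - r) * (m i - F)) =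
      (1 - r) * (m i - μ) ^ 2 + μ * ((1 - r) * (m i - F)) + (1 - r) * (μ - F) * (m i - μ) :=
    fun i => by ring
  simp_rw [h1, Finset.sum_add_distrib, ← Finset.mul_sum, Finset.sum_sub_distrib]
  rw [hμ]
  simp

theorem harmonicExt_cons_sub (f : List (Fin b) → ℝ) {n h : ℕ} {w : List (Fin b)}
    (hw : w.length + h + 1 = n) (a : Fin b) : harmonicExt f n (a :: w) - harmonicExt f n w =
      (1 - upRatio b h) * (leafMean f h (a :: w) - harmonicExt f n w) := by
  rw [harmonicExt_cons f hw]
  ring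

/-- The flow of the harmonic extension through an edge is the total flow into the leaves. -/
theorem leafSum_flow (hb : 2 ≤ b) (f : List (Fin b) → ℝ) {n : ℕ} :
    ∀ (h : ℕ) (a : Fin b) (w : List (Fin b)), w.length + h + 1 = n →
      leafSum (fun x => harmonicExt f n x - harmonicExt f n x.tail) h (a :: w) =
        harmonicExt f n (a :: w) - harmonicExt f n w
  | 0, a, w, _ => rfl
  | h + 1, a, w, hw => by
    rw [leafSum]
    have h1 := harmonicExt_interior hb f (n := n) (a := a) (w := w) (by lia)
    rw [Finset.sum_congr rfl fun a' _ => leafSum_flow hb f h a' (a :: w) (by simp; lia),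
      Finset.sum_sub_distrib]
    simp only [Finset.sum_const, Finset.card_univ, Fintype.card_fin, nsmul_eq_mul]
    linarith

theorem leafSum_flow_root (hb : 2 ≤ b) (f : List (Fin b) → ℝ) {n : ℕ} (hn : n ≠ 0) :
    leafSum (fun x => harmonicExt f n x - harmonicExt f n x.tail) n [] = 0 := by
  obtain ⟨h, rfl⟩ := Nat.exists_eq_succ_of_ne_zero hn
  rw [leafSum, Finset.sum_congr rfl fun a _ => leafSum_flow hb f h a [] (by simp),
    Finset.sum_sub_distrib, harmonicExt_root (by lia) f hn]
  simp

theorem sum_leafMean_mul_flow (hb : 2 ≤ b) (f : List (Fin b) → ℝ) {n h : ℕ} {w : List (Fin b)}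
    (hw : w.length + h + 1 = n) :
    ∑ a, leafMean f h (a :: w) * (harmonicExt f n (a :: w) - harmonicExt f n w) =
      (1 - upRatio b h) * ∑ a, (leafMean f h (a :: w) - leafMean f (h + 1) w) ^ 2 +
        leafMean f (h + 1) w * ∑ a, (harmonicExt f n (a :: w) - harmonicExt f n w) := by
  simp_rw [harmonicExt_cons_sub f hw]
  refine sum_mul_sub_eq _ ?_
  rw [sum_leafMean (by lia), Fintype.card_fin]

/-- Summation by parts, one level at a time. The boundary term is the leaf mean times the flow
through the top edge, and harmonicity merges the children's flows into that flow. -/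
theorem leafSum_mul_flow (hb : 2 ≤ b) (f : List (Fin b) → ℝ) {n : ℕ} :
    ∀ (h : ℕ) (a : Fin b) (w : List (Fin b)), w.length + h + 1 = n →
      leafSum (fun x => f x * (harmonicExt f n x - harmonicExt f n x.tail)) h (a :: w) =
        leafEnergy f h (a :: w) +
          leafMean f h (a :: w) * (harmonicExt f n (a :: w) - harmonicExt f n w)
  | 0, a, w, _ => by simp [leafSum, leafEnergy, leafMean]
  | h + 1, a, w, hw => by
    have h1 := harmonicExt_interior hb f (n := n) (a := a) (w := w) (by lia)
    have hw' : (a :: w).length + h + 1 = n := by simp; lia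
    rw [leafSum, Finset.sum_congr rfl fun a' _ => leafSum_mul_flow hb f h a' (a :: w) hw',
      Finset.sum_add_distrib, sum_leafMean_mul_flow hb f hw', Finset.sum_sub_distrib, leafEnergy]
    simp only [Finset.sum_const, Finset.card_univ, Fintype.card_fin, nsmul_eq_mul]
    rw [← add_assoc]
    congr 2
    linarith

/-- The energy of `f` as the flow out of the leaves weighted by `f`. -/
theorem leafSum_mul_flow_root (hb : 2 ≤ b) (f : List (Fin b) → ℝ) {n : ℕ} (hn : n ≠ 0) :
    leafSum (fun x => f x * (harmonicExt f n x - harmonicExt f n x.tail)) n [] =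
      leafEnergy f n [] := by
  obtain ⟨h, rfl⟩ := Nat.exists_eq_succ_of_ne_zero hn
  rw [leafSum, Finset.sum_congr rfl fun a _ => leafSum_mul_flow hb f h a [] (by simp),
    Finset.sum_add_distrib, sum_leafMean_mul_flow hb f (by simp), Finset.sum_sub_distrib,
    harmonicExt_root (by lia) f hn, leafEnergy]
  simp

theorem leafSum_eq_sum (f : List (Fin b) → ℝ) :
    ∀ (h : ℕ) (w : List (Fin b)), leafSum f h w = ∑ v : List.Vector (Fin b) h, f (v.1 ++ w)
  | 0, w => by
    rw [leafSum, Fintype.sum_eq_single List.Vector.nil (fun v hv => absurd (Subsingleton.elim _ _) hv)]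
    rfl
  | h + 1, w => by
    rw [leafSum]
    simp_rw [leafSum_eq_sum f h]
    -- Words list the letter nearest the leaf first, so the child chosen at the top is the last
    -- letter of the longer word.
    let e : Fin b × List.Vector (Fin b) h ≃ List.Vector (Fin b) (h + 1) :=
      { toFun := fun p => ⟨p.2.1 ++ [p.1], by simp [p.2.2]⟩
        invFun := fun v => ⟨v.1.getLast (by
            have := v.2
            intro h0
            simp [h0] at this), ⟨v.1.dropLast, by simp [v.2]⟩⟩
        left_inv := fun p => by
          ext1 <;> simp
          rfl
        right_inv := fun v => by
          apply Subtype.ext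
          exact List.dropLast_append_getLast _ }
    rw [← e.sum_comp, Fintype.sum_prod_type]
    refine Finset.sum_congr rfl fun a _ => Finset.sum_congr rfl fun v _ => ?_
    change _ = f ((v.1 ++ [a]) ++ w)
    simp

end Harmonic

theorem sum_leaves {b n : ℕ} (f : List (Fin b) → ℝ) :
    ∑ x : leaves b n, f x.1.1 = leafSum f n [] := by
  rw [leafSum_eq_sum]
  let e : List.Vector (Fin b) n ≃ leaves b n :=
    { toFun := fun v => ⟨⟨v.1, v.2.le⟩, v.2⟩
      invFun := fun x => ⟨x.1.1, x.2⟩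
      left_inv := fun _ => rfl
      right_inv := fun _ => rfl }
  rw [← e.sum_comp]
  exact Finset.sum_congr rfl fun v _ => congrArg f (List.append_nil v.1).symm

/-! ### Simple random walk stopped at its first return to a set -/

section Avoids

variable {V : Type*}

/-- The trajectories that do not return to `L` up to time `t`. -/
def avoids (L : Set V) (t : ℕ) : Set (ℕ → V) := {X | ∀ s, 1 ≤ s → s ≤ t → X s ∉ L}

theorem avoids_eq_preimage {L : Set V} (t : ℕ) : avoids L t = Preorder.frestrictLe (π := fun _ => V) t ⁻¹'
    {h | ∀ s : Finset.Iic t, 1 ≤ s.1 → h s ∉ L} := by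
  ext X
  simp only [avoids, Set.mem_ofPred_eq, Set.mem_preimage, Preorder.frestrictLe_apply]
  exact ⟨fun H s hs => H s hs (Finset.mem_Iic.1 s.2), fun H s h1 h2 => H ⟨s, Finset.mem_Iic.2 h2⟩ h1⟩

theorem avoids_succ {L : Set V} (t : ℕ) : avoids L (t + 1) = avoids L t ∩ {X | X (t + 1) ∈ L}ᶜ := by
  ext X
  constructor
  · exact fun H => ⟨fun s h1 h2 => H s h1 (by lia), H (t + 1) (by lia) le_rfl⟩
  · rintro ⟨H, H'⟩ s h1 h2
    rcases h2.lt_or_eq with h | rfl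
    · exact H s h1 (by lia)
    · exact H'

end Avoids

section Walk

variable {V : Type*} [MeasurableSpace V] [DiscreteMeasurableSpace V] [Finite V]

theorem integral_stepMeasure (G : SimpleGraph V) {v : V} {s : Finset V} (hs : s.Nonempty)
    (hsv : G.neighborSet v = s) (F : V → ℝ) :
    ∫ u, F u ∂stepMeasure G v = (∑ u ∈ s, F u) / s.card := by
  have hne : (G.neighborSet v).Nonempty := hsv ▸ hs
  have : IsFiniteMeasure (Measure.count : Measure V) := ⟨Measure.count_apply_lt_top.2 Set.finite_univ⟩
  rw [stepMeasure, if_pos hne, uniformOn, ProbabilityTheory.cond, integral_smul_measure, hsv,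
    setIntegral_finset s Integrable.of_finite.integrableOn, Measure.count_apply_finset]
  simp [measureReal_def, div_eq_inv_mul]

variable (G : SimpleGraph V) (v : V)

theorem map_eval_zero_walkLaw : (walkLaw G v).map (fun X => X 0) = Measure.dirac v := by
  have h1 : (walkLaw G v).map (Preorder.frestrictLe 0) =
      (Measure.dirac v).map (MeasurableEquiv.piUnique fun _ : Finset.Iic 0 => V).symm := by
    unfold walkLaw Kernel.trajMeasure
    rw [Measure.map_comp _ _ (by fun_prop), Kernel.traj_map_frestrictLe, Kernel.partialTraj_self,
      Measure.id_comp]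
  have h2 : (fun X : ℕ → V => X 0) =
      (MeasurableEquiv.piUnique fun _ : Finset.Iic 0 => V) ∘ Preorder.frestrictLe 0 := by
    ext X
    rfl
  rw [h2, ← Measure.map_map (by fun_prop) (by fun_prop), h1, Measure.map_map (by fun_prop)
    (by fun_prop)]
  simp

theorem integrable_walkLaw (F : V → ℝ) (t : ℕ) : Integrable (fun X => F (X t)) (walkLaw G v) := by
  have : Integrable F ((walkLaw G v).map fun X => X t) := by
    have : IsProbabilityMeasure ((walkLaw G v).map fun X => X t) :=
      Measure.isProbabilityMeasure_map (measurable_pi_apply t).aemeasurable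
    exact Integrable.of_finite
  exact this.comp_measurable (measurable_pi_apply t)

/-- The Markov property at time t, restricted to an event that depends only on the trajectory up to
t. -/
theorem setIntegral_walkLaw_succ (F : V → ℝ) (t : ℕ) (A : Set (Finset.Iic t → V)) :
    ∫ X in Preorder.frestrictLe (π := fun _ => V) t ⁻¹' A, F (X (t + 1)) ∂walkLaw G v =
      ∫ X in Preorder.frestrictLe (π := fun _ => V) t ⁻¹' A, (∫ u, F u ∂stepMeasure G (X t))
        ∂walkLaw G v := by
  set μ := walkLaw G v with hμ
  have key : μ.map (Preorder.frestrictLe t) ⊗ₘ historyKernel G t =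
      μ.map (fun x ↦ (Preorder.frestrictLe t x, x (t + 1))) :=
    Kernel.map_frestrictLe_trajMeasure_compProd_eq_map_trajMeasure
  have hprob : IsProbabilityMeasure (μ.map (Preorder.frestrictLe (π := fun _ => V) t)) :=
    Measure.isProbabilityMeasure_map (by fun_prop)
  have h1 := Measure.setIntegral_compProd (μ := μ.map (Preorder.frestrictLe (π := fun _ => V) t))
    (κ := historyKernel G t) (s := A) (t := Set.univ)
    MeasurableSet.of_discrete MeasurableSet.univ (f := fun p => F p.2)
    Integrable.of_finite.integrableOn
  rw [key, setIntegral_map (MeasurableSet.of_discrete)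
    (Integrable.of_finite (f := fun p : (Finset.Iic t → V) × V =>
      F p.2)).aestronglyMeasurable (by fun_prop)] at h1
  rw [setIntegral_map MeasurableSet.of_discrete
    (Integrable.of_finite (f := _)).aestronglyMeasurable (by fun_prop)] at h1
  simp only [Measure.restrict_univ] at h1
  convert! h1 using 2

  congr 1
  ext X
  simp

theorem integral_walkLaw_one (F : V → ℝ) :
    ∫ X, F (X 1) ∂walkLaw G v = ∫ u, F u ∂stepMeasure G v := by
  have h1 := setIntegral_walkLaw_succ G v F 0 Set.univ
  simp only [Set.preimage_univ, Measure.restrict_univ, zero_add] at h1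
  rw [h1]
  have h2 := integral_map (μ := walkLaw G v) (φ := fun X => X 0)
    (f := fun w => ∫ u, F u ∂stepMeasure G w) (measurable_pi_apply 0).aemeasurable
    (by rw [map_eval_zero_walkLaw]; exact AEStronglyMeasurable.of_discrete)
  rw [← h2, map_eval_zero_walkLaw, integral_dirac]

variable (L : Set V)

variable {L} in
theorem measurableSet_avoids (t : ℕ) : MeasurableSet (avoids L t) := by
  rw [avoids_eq_preimage]
  exact (Preorder.measurable_frestrictLe (X := fun _ : ℕ => V) t) MeasurableSet.of_discrete

variable {L} in
-- The walk either returns at time t + 1 or survives; on survival `F` is split into its one-step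
-- average and a defect. The defect vanishes for harmonic `F` and is at least δ for a drifting
-- potential.
theorem setIntegral_avoids (F : V → ℝ) (t : ℕ) :
    ∫ X in avoids L t, F (X (t + 1)) ∂walkLaw G v =
      ∫ X in avoids L t ∩ {X | X (t + 1) ∈ L}, F (X (t + 1)) ∂walkLaw G v +
        ∫ X in avoids L (t + 1), (∫ u, F u ∂stepMeasure G (X (t + 1))) ∂walkLaw G v +
        ∫ X in avoids L (t + 1), (F (X (t + 1)) - ∫ u, F u ∂stepMeasure G (X (t + 1)))
          ∂walkLaw G v := by
  rw [integral_sub (integrable_walkLaw G v _ _).integrableOn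
    (integrable_walkLaw G v (fun w => ∫ u, F u ∂stepMeasure G w) _).integrableOn]
  have hm : MeasurableSet {X : ℕ → V | X (t + 1) ∈ L} :=
    measurable_pi_apply (t + 1) (MeasurableSet.of_discrete (s := L))
  have := integral_inter_add_sdiff (μ := walkLaw G v) (s := avoids L t) hm (integrable_walkLaw G v F (t + 1)).integrableOn
  rw [← this, avoids_succ, Set.sdiff_eq]
  ring

theorem setIntegral_avoids_succ (F : V → ℝ) (t : ℕ) :
    ∫ X in avoids L t, (∫ u, F u ∂stepMeasure G (X t)) ∂walkLaw G v =
      ∫ X in avoids L t, F (X (t + 1)) ∂walkLaw G v := by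
  rw [avoids_eq_preimage, setIntegral_walkLaw_succ]

/-- A walk that drifts towards `L` returns to `L`. -/
theorem tendsto_measure_avoids {H : V → ℝ} {δ : ℝ} (hδ : 0 < δ) (hH : ∀ u, 0 ≤ H u)
    (hdrift : ∀ u ∉ L, ∫ w, H w ∂stepMeasure G u ≤ H u - δ) :
    Tendsto (fun t => (walkLaw G v).real (avoids L t)) atTop (𝓝 0) := by
  -- The expected potential on survival drops by at least δ times the probability of surviving one
  -- more step, so those probabilities are summable.
  set a : ℕ → ℝ := fun t => ∫ X in avoids L t, H (X (t + 1)) ∂walkLaw G v with ha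
  have hstep : ∀ t, δ * (walkLaw G v).real (avoids L (t + 1)) + a (t + 1) ≤ a t := by
    intro t
    have h1 := setIntegral_avoids (L := L) G v H t
    rw [setIntegral_avoids_succ] at h1
    have h2 : 0 ≤ ∫ X in avoids L t ∩ {X | X (t + 1) ∈ L}, H (X (t + 1)) ∂walkLaw G v :=
      integral_nonneg fun _ => hH _
    have h3 : δ * (walkLaw G v).real (avoids L (t + 1)) ≤
        ∫ X in avoids L (t + 1), (H (X (t + 1)) - ∫ u, H u ∂stepMeasure G (X (t + 1)))
          ∂walkLaw G v := by
      refine setIntegral_ge_of_const_le_real (measurableSet_avoids _) (measure_ne_top _ _)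
        (fun X hX => ?_) ?_
      · have := hdrift (X (t + 1)) (hX (t + 1) (by lia) le_rfl)
        linarith
      · exact (integrable_walkLaw G v (fun w => H w - ∫ u, H u ∂stepMeasure G w) _).integrableOn
    change _ ≤ ∫ X in avoids L t, H (X (t + 1)) ∂walkLaw G v
    rw [h1]
    change _ ≤ _ + a (t + 1) + _
    linarith
  have hsum : ∀ n, ∑ t ∈ Finset.range n, δ * (walkLaw G v).real (avoids L (t + 1)) + a n ≤ a 0 := by
    intro n
    induction n with
    | zero => simp
    | succ n ih =>
      rw [Finset.sum_range_succ]
      have := hstep n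
      linarith
  have hs : Summable fun t => δ * (walkLaw G v).real (avoids L (t + 1)) := by
    refine summable_of_sum_range_le (c := a 0) (fun t => mul_nonneg hδ.le measureReal_nonneg) fun n => ?_
    have : 0 ≤ a n := integral_nonneg fun _ => hH _
    linarith [hsum n]
  have h0 := hs.tendsto_atTop_zero.const_mul δ⁻¹
  simp only [inv_mul_cancel_left₀ hδ.ne', mul_zero] at h0
  exact (tendsto_add_atTop_iff_nat 1).1 h0

/-- Optional stopping at the first return to `L`. -/
theorem tendsto_sum_setIntegral_return {F H : V → ℝ} {δ : ℝ} (hδ : 0 < δ) (hH : ∀ u, 0 ≤ H u)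
    (hdrift : ∀ u ∉ L, ∫ w, H w ∂stepMeasure G u ≤ H u - δ)
    (hF : ∀ u ∉ L, ∫ w, F w ∂stepMeasure G u = F u) :
    Tendsto (fun n => ∑ t ∈ Finset.range n,
      ∫ X in avoids L t ∩ {X | X (t + 1) ∈ L}, F (X (t + 1)) ∂walkLaw G v) atTop
        (𝓝 (∫ u, F u ∂stepMeasure G v)) := by
  set a : ℕ → ℝ := fun t => ∫ X in avoids L t, F (X (t + 1)) ∂walkLaw G v with ha
  have hstep : ∀ t, ∫ X in avoids L t ∩ {X | X (t + 1) ∈ L}, F (X (t + 1)) ∂walkLaw G v =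
      a t - a (t + 1) := by
    intro t
    have h1 := setIntegral_avoids (L := L) G v F t
    rw [setIntegral_avoids_succ] at h1
    have h2 : ∫ X in avoids L (t + 1), (F (X (t + 1)) - ∫ u, F u ∂stepMeasure G (X (t + 1)))
          ∂walkLaw G v = 0 := by
      refine setIntegral_eq_zero_of_forall_eq_zero fun X hX => ?_
      rw [hF _ (hX (t + 1) (by lia) le_rfl), sub_self]
    rw [ha]
    dsimp only
    linarith
  have ha0 : a 0 = ∫ u, F u ∂stepMeasure G v := by
    have : avoids L 0 = Set.univ := Set.eq_univ_of_forall fun X s h1 h2 => by lia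
    rw [ha, ← integral_walkLaw_one]
    simp [this]
  obtain ⟨C, hC⟩ := (Set.finite_range fun u => ‖F u‖).bddAbove
  have hlim : Tendsto a atTop (𝓝 0) := by
    refine squeeze_zero_norm (a := fun t => C * (walkLaw G v).real (avoids L t)) (fun t => ?_) ?_
    · exact norm_setIntegral_le_of_norm_le_const (measure_lt_top _ _)
        fun X _ => hC ⟨X (t + 1), rfl⟩
    · simpa using (tendsto_measure_avoids G v L hδ hH hdrift).const_mul C
  simp_rw [hstep, Finset.sum_range_sub']
  rw [← ha0]
  simpa using hlim.const_sub (a 0)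

end Walk

/-! ### The return distribution on the tree -/

section Tree

variable {b n : ℕ}

theorem integral_stepMeasure_root (hb : b ≠ 0) (hn : n ≠ 0) {v : Vertex b n} (hv : v.1 = [])
    (φ : List (Fin b) → ℝ) : ∫ u, φ u.1 ∂stepMeasure (tree b n) v = (∑ a, φ [a]) / b := by
  classical
  let child : Fin b ↪ Vertex b n :=
    ⟨fun a => ⟨[a], by simp; lia⟩, fun a a' h => by simpa using congrArg Subtype.val h⟩
  rw [integral_stepMeasure (tree b n) (s := Finset.univ.map child)]
  · rw [Finset.sum_map, Finset.card_map, Finset.card_univ, Fintype.card_fin]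
    rfl
  · have : NeZero b := ⟨hb⟩
    exact ⟨child 0, by simp⟩
  · ext u
    simp only [SimpleGraph.mem_neighborSet, tree, hv, Finset.coe_map, Set.mem_image, Finset.coe_univ,
      Set.mem_univ, true_and]
    constructor
    · rintro (⟨a, h⟩ | ⟨a, h⟩)
      · simp at h
      · exact ⟨a, Subtype.ext h.symm⟩
    · rintro ⟨a, rfl⟩
      exact Or.inr ⟨a, rfl⟩

theorem integral_stepMeasure_interior {a : Fin b} {w : List (Fin b)} (hw : w.length + 1 < n)
    {v : Vertex b n} (hv : v.1 = a :: w) (φ : List (Fin b) → ℝ) :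
    ∫ u, φ u.1 ∂stepMeasure (tree b n) v =
      (∑ a', φ (a' :: a :: w) + φ w) / (b + 1) := by
  classical
  let child : Fin b ↪ Vertex b n :=
    ⟨fun a' => ⟨a' :: a :: w, hw⟩, fun a a' h => by simpa using congrArg Subtype.val h⟩
  let parent : Vertex b n := ⟨w, by lia⟩
  have hp : parent ∉ Finset.univ.map child := by
    simp only [Finset.mem_map, Finset.mem_univ, true_and, not_exists]
    intro a' h
    have : (a' :: a :: w).length = w.length :=
      congrArg (fun v : Vertex b n => v.1.length) h
    simp at this
    lia
  rw [integral_stepMeasure (tree b n) (s := insert parent (Finset.univ.map child))]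
  · rw [Finset.sum_insert hp, Finset.card_insert_of_notMem hp]
    rw [Finset.sum_map, Finset.card_map, Finset.card_univ, Fintype.card_fin, add_comm]
    push_cast
    rfl
  · exact ⟨parent, by simp⟩
  · ext u
    simp only [SimpleGraph.mem_neighborSet, tree, hv, Finset.coe_insert, Finset.coe_map, Set.mem_image,
      Finset.coe_univ, Set.mem_univ, true_and, Set.mem_insert_iff]
    constructor
    · rintro (⟨a', h⟩ | ⟨a', h⟩)
      · exact Or.inl (Subtype.ext (List.cons.inj h).2.symm)
      · exact Or.inr ⟨a', Subtype.ext h.symm⟩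
    · rintro (rfl | ⟨a', rfl⟩)
      · exact Or.inl ⟨a, rfl⟩
      · exact Or.inr ⟨a', rfl⟩

theorem integral_stepMeasure_leaf {a : Fin b} {w : List (Fin b)} (hw : w.length + 1 = n)
    {v : Vertex b n} (hv : v.1 = a :: w) (φ : List (Fin b) → ℝ) :
    ∫ u, φ u.1 ∂stepMeasure (tree b n) v = φ w := by
  let parent : Vertex b n := ⟨w, by lia⟩
  rw [integral_stepMeasure (tree b n) (s := {parent})]
  · rw [Finset.sum_singleton, Finset.card_singleton, Nat.cast_one, div_one]
  · exact ⟨parent, by simp⟩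
  · ext u
    simp only [SimpleGraph.mem_neighborSet, tree, hv, Finset.coe_singleton, Set.mem_singleton_iff]
    constructor
    · rintro (⟨a', h⟩ | ⟨a', h⟩)
      · exact Subtype.ext (List.cons.inj h).2.symm
      · have h1 := u.2
        rw [h] at h1
        simp at h1
        lia
    · rintro rfl
      exact Or.inl ⟨a, rfl⟩

theorem integral_stepMeasure_harmonicExt (hb : 2 ≤ b) (f : List (Fin b) → ℝ) {v : Vertex b n}
    (hv : v ∉ leaves b n) :
    ∫ u, harmonicExt f n u.1 ∂stepMeasure (tree b n) v = harmonicExt f n v.1 := by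
  have hlt : v.1.length < n := lt_of_le_of_ne v.2 hv
  have hb' : (b : ℝ) ≠ 0 := Nat.cast_ne_zero.2 (by lia)
  cases hw : v.1 with
  | nil =>
    have hn : n ≠ 0 := by lia
    rw [integral_stepMeasure_root (by lia) hn hw, harmonicExt_root (by lia) f hn,
      mul_div_cancel_left₀ _ hb']
  | cons a w =>
    rw [hw] at hlt
    rw [integral_stepMeasure_interior hlt hw, harmonicExt_interior hb f hlt]
    field_simp

/-- The mean drop in height is 1 at the apex and (b - 1)/(b + 1) elsewhere off the leaves; the
latter is 1/3 for b = 2 and larger otherwise. -/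
theorem integral_stepMeasure_height (hb : 2 ≤ b) {v : Vertex b n} (hv : v ∉ leaves b n) :
    ∫ u, ((n : ℝ) - u.1.length) ∂stepMeasure (tree b n) v ≤ ((n : ℝ) - v.1.length) - 1 / 3 := by
  have hlt : v.1.length < n := lt_of_le_of_ne v.2 hv
  have hb2 : (2 : ℝ) ≤ b := by exact_mod_cast hb
  cases hw : v.1 with
  | nil =>
    have hn : n ≠ 0 := by lia
    rw [integral_stepMeasure_root (by lia) hn hw (fun u => (n : ℝ) - u.length)]
    simp only [List.length_cons, List.length_nil, Finset.sum_const, Finset.card_univ,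
      Fintype.card_fin, nsmul_eq_mul]
    rw [mul_div_cancel_left₀ _ (by linarith)]
    push_cast
    linarith
  | cons a w =>
    rw [hw] at hlt
    rw [integral_stepMeasure_interior hlt hw (fun u => (n : ℝ) - u.length)]
    simp only [List.length_cons, Finset.sum_const, Finset.card_univ,
      Fintype.card_fin, nsmul_eq_mul]
    rw [div_le_iff₀ (by linarith)]
    push_cast
    nlinarith

/-- The probability that the walk started at the leaf `x` first returns to the leaves at `y`. -/
def returnProb (x y : leaves b n) : ℝ := (walkLaw (tree b n) x.1).real {X | EndsAt X y}

theorem returnProb_nonneg (x y : leaves b n) : 0 ≤ returnProb x y := measureReal_nonneg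

theorem setOf_endsAt (y : leaves b n) : {X | EndsAt X y} =
    ⋃ t, avoids (leaves b n) t ∩ (fun X => X (t + 1)) ⁻¹' {y.1} := by
  ext X
  simp only [EndsAt, Set.mem_ofPred_eq, Set.mem_iUnion, Set.mem_inter_iff, avoids,
    Set.mem_preimage, Set.mem_singleton_iff]
  constructor
  · rintro ⟨t, ht, hy, h⟩
    obtain ⟨t, rfl⟩ := Nat.exists_eq_add_of_le' ht
    exact ⟨t, fun s h1 h2 => h s h1 (by lia), hy⟩
  · rintro ⟨t, h, hy⟩
    exact ⟨t + 1, by lia, hy, fun s h1 h2 => h s h1 (by lia)⟩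

theorem measurableSet_avoids_inter (t : ℕ) (A : Set (Vertex b n)) :
    MeasurableSet (avoids (leaves b n) t ∩ (fun X => X (t + 1)) ⁻¹' A) :=
  (measurableSet_avoids t).inter (measurable_pi_apply (t + 1) MeasurableSet.of_discrete)

theorem measurableSet_endsAt (y : leaves b n) : MeasurableSet {X | EndsAt X y} := by
  rw [setOf_endsAt]
  exact MeasurableSet.iUnion fun t => measurableSet_avoids_inter t _

theorem EndsAt.unique {X : ℕ → Vertex b n} {y z : leaves b n} (hy : EndsAt X y) (hz : EndsAt X z) :
    y = z := by
  obtain ⟨t, ht, hy, h⟩ := hy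
  obtain ⟨t', ht', hz, h'⟩ := hz
  rcases lt_trichotomy t t' with hlt | rfl | hlt
  · exact absurd (hy ▸ y.2) (h' t ht hlt)
  · exact Subtype.ext (hy.symm.trans hz)
  · exact absurd (hz ▸ z.2) (h t' ht' hlt)

theorem hasSum_returnProb (x y : leaves b n) :
    HasSum (fun t => (walkLaw (tree b n) x.1).real
      (avoids (leaves b n) t ∩ (fun X => X (t + 1)) ⁻¹' {y.1})) (returnProb x y) := by
  have h := hasSum_integral_iUnion (μ := walkLaw (tree b n) x.1) (f := fun _ => (1 : ℝ))
    (s := fun t => avoids (leaves b n) t ∩ (fun X => X (t + 1)) ⁻¹' {y.1})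
    (fun t => measurableSet_avoids_inter t _) ?_ (integrable_const _).integrableOn
  · rw [← setOf_endsAt] at h
    simpa [returnProb] using h
  · have : ∀ t t', t < t' → Disjoint
        (avoids (leaves b n) t ∩ (fun X => X (t + 1)) ⁻¹' {y.1})
        (avoids (leaves b n) t' ∩ (fun X => X (t' + 1)) ⁻¹' {y.1}) := by
      intro t t' hlt
      rw [Set.disjoint_left]
      rintro X ⟨-, h1⟩ ⟨h2, -⟩
      refine h2 (t + 1) (by lia) (by lia) ?_
      rw [Set.mem_preimage, Set.mem_singleton_iff] at h1
      rw [h1]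
      exact y.2
    intro t t' hne
    rcases hne.lt_or_gt with h | h
    exacts [this t t' h, (this t' t h).symm]

/-- The mean of `f` at the point of first return is given by the harmonic extension of `f`. -/
theorem sum_returnProb_mul (hb : 2 ≤ b) (hn : n ≠ 0) (f : List (Fin b) → ℝ) (x : leaves b n) :
    ∑ y, returnProb x y * f y.1.1 = harmonicExt f n x.1.1.tail := by
  have hlim := tendsto_sum_setIntegral_return (tree b n) x.1 (leaves b n)
    (F := fun v => harmonicExt f n v.1) (H := fun v => (n : ℝ) - v.1.length)
    (δ := 1 / 3) (by norm_num) (fun u => sub_nonneg.2 (by exact_mod_cast u.2))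
    (fun u hu => integral_stepMeasure_height hb hu)
    (fun u hu => integral_stepMeasure_harmonicExt hb f hu)
  have hx : ∫ u, harmonicExt f n u.1 ∂stepMeasure (tree b n) x.1 =
      harmonicExt f n x.1.1.tail := by
    have hx : x.1.1.length = n := x.2
    cases hw : x.1.1 with
    | nil =>
      rw [hw] at hx
      exact absurd hx.symm hn
    | cons a w =>
      rw [hw] at hx
      exact integral_stepMeasure_leaf hx hw _
  rw [hx] at hlim
  have hterm : ∀ t, ∫ X in avoids (leaves b n) t ∩ {X | X (t + 1) ∈ leaves b n},
      harmonicExt f n (X (t + 1)).1 ∂walkLaw (tree b n) x.1 =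
        ∑ y : leaves b n, (walkLaw (tree b n) x.1).real
          (avoids (leaves b n) t ∩ (fun X => X (t + 1)) ⁻¹' {y.1}) * f y.1.1 := by
    intro t
    have hU : avoids (leaves b n) t ∩ {X | X (t + 1) ∈ leaves b n} =
        ⋃ y : leaves b n, avoids (leaves b n) t ∩ (fun X => X (t + 1)) ⁻¹' {y.1} := by
      ext X
      simp
    rw [hU, integral_iUnion_fintype (fun y => measurableSet_avoids_inter t _)]
    · refine Finset.sum_congr rfl fun y _ => ?_
      rw [setIntegral_congr_fun (g := fun _ => f y.1.1) (measurableSet_avoids_inter t _)]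
      · simp
      · rintro X ⟨-, hX⟩
        rw [Set.mem_preimage, Set.mem_singleton_iff] at hX
        dsimp only
        rw [hX, harmonicExt_leaf f y.2]
    · intro y z hyz
      rw [Function.onFun, Set.disjoint_left]
      rintro X ⟨-, h1⟩ ⟨-, h2⟩
      exact hyz (Subtype.ext (h1.symm.trans h2))
    · exact fun y => (integrable_walkLaw _ _ (fun v : Vertex b n => harmonicExt f n v.1) _).integrableOn
  simp_rw [hterm] at hlim
  have hsum : HasSum (fun t => ∑ y : leaves b n, (walkLaw (tree b n) x.1).real
      (avoids (leaves b n) t ∩ (fun X => X (t + 1)) ⁻¹' {y.1}) * f y.1.1)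
      (∑ y, returnProb x y * f y.1.1) :=
    hasSum_sum fun y _ => (hasSum_returnProb x y).mul_right _
  exact tendsto_nhds_unique hsum.tendsto_sum_nat hlim

theorem sum_returnProb (hb : 2 ≤ b) (hn : n ≠ 0) (x : leaves b n) : ∑ y, returnProb x y = 1 := by
  have h := sum_returnProb_mul hb hn (fun _ => 1) x
  have hmean : ∀ (h : ℕ) (w : List (Fin b)), leafMean (fun _ => (1 : ℝ)) h w = 1 := by
    intro h
    induction h with
    | zero => exact fun _ => rfl
    | succ h ih =>
      intro w
      simp [leafMean, ih, (by lia : b ≠ 0)]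
  have hext : ∀ w : List (Fin b), harmonicExt (fun _ => (1 : ℝ)) n w = 1 := by
    intro w
    induction w with
    | nil => exact hmean _ _
    | cons a w ih => rw [harmonicExt, ih, hmean]; ring
  simpa [hext] using h

/-- Half of the total rate of the pairs of leaves for which `R` holds. -/
def rate (R : leaves b n → leaves b n → Prop) : ℝ :=
  open Classical in (∑ x, ∑ y, if R x y then returnProb x y else 0) / 2

/-- The leaves `x` and `y` are on different sides of the cut `S`. -/
def Cuts (S : Set (leaves b n)) (x y : leaves b n) : Prop := ¬(x ∈ S ↔ y ∈ S)

/-- The indicator function of a set of leaves, on words. -/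
def leafIndicator (S : Set (leaves b n)) (l : List (Fin b)) : ℝ :=
  open Classical in if ∃ x ∈ S, x.1.1 = l then 1 else 0

theorem leafIndicator_apply (S : Set (leaves b n)) [DecidablePred (· ∈ S)] (x : leaves b n) :
    leafIndicator S x.1.1 = if x ∈ S then 1 else 0 := by
  unfold leafIndicator
  by_cases hx : x ∈ S
  · rw [if_pos hx, if_pos ⟨x, hx, rfl⟩]
  · rw [if_neg hx, if_neg]
    rintro ⟨y, hy, h⟩
    exact hx (Subtype.ext (Subtype.ext h) ▸ hy)

/-- The rate of a cut is the Dirichlet energy of the harmonic extension of its indicator. -/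
theorem rate_cuts (hb : 2 ≤ b) (hn : n ≠ 0) (S : Set (leaves b n)) :
    rate (Cuts S) = leafEnergy (leafIndicator S) n [] := by
  classical
  set f := leafIndicator S with hf
  -- For an indicator f, being separated by the cut is f x + f y - 2 f x f y.
  have h1 : ∀ x y : leaves b n, (if Cuts S x y then returnProb x y else 0) =
      returnProb x y * f x.1.1 + returnProb x y * f y.1.1 -
        2 * (f x.1.1 * (returnProb x y * f y.1.1)) := by
    intro x y
    rw [hf, leafIndicator_apply, leafIndicator_apply]
    by_cases hx : x ∈ S <;> by_cases hy : y ∈ S <;> (simp [Cuts, hx, hy]; try ring)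
  have h2 : ∀ x : leaves b n, ∑ y, (if Cuts S x y then returnProb x y else 0) =
      2 * (f x.1.1 * (harmonicExt f n x.1.1 - harmonicExt f n x.1.1.tail)) -
        (harmonicExt f n x.1.1 - harmonicExt f n x.1.1.tail) := by
    intro x
    have hsq : f x.1.1 * f x.1.1 = f x.1.1 := by
      rw [hf, leafIndicator_apply]; split_ifs <;> norm_num
    simp_rw [h1, Finset.sum_sub_distrib, Finset.sum_add_distrib, ← Finset.mul_sum,
      ← Finset.sum_mul]
    rw [sum_returnProb hb hn, sum_returnProb_mul hb hn, harmonicExt_leaf f x.2]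
    linear_combination (-2) * hsq
  -- The quadratic part sums to twice the energy and the linear part is the total flow, which is
  -- zero. Conservation of flow makes the symmetry of `returnProb` unnecessary.
  have h3 := leafSum_mul_flow_root hb f hn
  have h4 := leafSum_flow_root hb f hn
  rw [← sum_leaves] at h3 h4
  unfold rate
  have : ∑ x, ∑ y, (if Cuts S x y then returnProb x y else 0) = 2 * leafEnergy f n [] := by
    simp_rw [h2]
    rw [Finset.sum_sub_distrib, ← Finset.mul_sum, h3, h4, sub_zero]
  rw [← mul_div_cancel_left₀ (leafEnergy f n []) two_ne_zero, ← this]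

end Tree

/-! ### The probability that a family of edges is absent -/

section Law

variable {b n : ℕ}

/-- No particle moves from a leaf `x` to a leaf `y` for which `R x y` holds. -/
def noEdge (R : leaves b n → leaves b n → Prop) : Set (Outcome b n) :=
  {ω | ∀ x, ∀ i < (ω x).1, ∀ y, R x y → ¬EndsAt ((ω x).2 i) y}

theorem measurableSet_forall_not_endsAt (Y : Set (leaves b n)) :
    MeasurableSet {X | ∀ y ∈ Y, ¬EndsAt X y} := by
  have : {X | ∀ y ∈ Y, ¬EndsAt X y} = ⋂ y ∈ Y, {X : ℕ → Vertex b n | EndsAt X y}ᶜ := by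
    ext X; simp
  rw [this]
  exact MeasurableSet.biInter (Set.to_countable Y) fun y _ => (measurableSet_endsAt y).compl

theorem measureReal_forall_not_endsAt (x : leaves b n) (Y : Finset (leaves b n)) :
    (walkLaw (tree b n) x.1).real {X | ∀ y ∈ Y, ¬EndsAt X y} = 1 - ∑ y ∈ Y, returnProb x y := by
  have h1 : {X | ∀ y ∈ Y, ¬EndsAt X y} = (⋃ y ∈ Y, {X : ℕ → Vertex b n | EndsAt X y})ᶜ := by
    ext X; simp
  rw [h1, probReal_compl_eq_one_sub (Finset.measurableSet_biUnion _ fun y _ => measurableSet_endsAt y),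
    measureReal_biUnion_finset _ fun y _ => measurableSet_endsAt y]
  · rfl
  · intro y _ z _ hyz
    exact Set.disjoint_left.2 fun X hy hz => hyz (EndsAt.unique hy hz)

/-- Thinning a Poisson number of independent particles. -/
theorem poisson_prod_infinitePi_apply {W : Type*} [MeasurableSpace W] (μ : Measure W)
    [IsProbabilityMeasure μ] (r : NNReal) {B : Set W} (hB : MeasurableSet B) :
    MeasurableSet {p : ℕ × (ℕ → W) | ∀ i < p.1, p.2 i ∈ B} ∧
    ((poissonMeasure r).prod (Measure.infinitePi fun _ : ℕ => μ))
      {p | ∀ i < p.1, p.2 i ∈ B} = ENNReal.ofReal (Real.exp (-(r * (1 - μ.real B)))) := by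
  have hm : MeasurableSet {p : ℕ × (ℕ → W) | ∀ i < p.1, p.2 i ∈ B} := by
    have : {p : ℕ × (ℕ → W) | ∀ i < p.1, p.2 i ∈ B} =
        ⋂ i : ℕ, (Prod.fst ⁻¹' {k | ¬i < k} ∪ Prod.snd ⁻¹' ((fun X => X i) ⁻¹' B)) := by
      ext p
      simp only [Set.mem_ofPred_eq, Set.mem_iInter, Set.mem_union, Set.mem_preimage]
      exact forall_congr' fun i => imp_iff_not_or
    rw [this]
    exact MeasurableSet.iInter fun i => (measurable_fst MeasurableSet.of_discrete).union
      (measurable_snd (measurable_pi_apply i hB))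
  refine ⟨hm, ?_⟩
  have hk : ∀ k : ℕ, (Measure.infinitePi fun _ : ℕ => μ)
      (Prod.mk k ⁻¹' {p : ℕ × (ℕ → W) | ∀ i < p.1, p.2 i ∈ B}) = ENNReal.ofReal (μ.real B ^ k) := by
    intro k
    have : Prod.mk k ⁻¹' {p : ℕ × (ℕ → W) | ∀ i < p.1, p.2 i ∈ B} =
        Set.pi (Finset.range k : Set ℕ) fun _ => B := by
      ext X; simp
    rw [this, Measure.infinitePi_pi (fun _ : ℕ => μ) fun _ _ => hB, Finset.prod_const, Finset.card_range,
      ENNReal.ofReal_pow measureReal_nonneg, ofReal_measureReal]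
  rw [Measure.prod_apply hm]
  simp_rw [hk]
  rw [poissonMeasure, lintegral_sum_measure]
  simp_rw [lintegral_smul_measure, lintegral_dirac, smul_eq_mul]
  have hs : HasSum (fun k : ℕ => Real.exp (-r) * r ^ k / (k.factorial : ℝ) * μ.real B ^ k)
      (Real.exp (-(r * (1 - μ.real B)))) := by
    convert! (NormedSpace.expSeries_div_hasSum_exp (r * μ.real B : ℝ)).mul_left (Real.exp (-r))
      using 1
    · ext k; rw [mul_pow]; ring
    · rw [← Real.exp_eq_exp_ℝ, ← Real.exp_add]; congr 1; ring
  have hnn : ∀ k : ℕ, 0 ≤ Real.exp (-r) * r ^ k / (k.factorial : ℝ) * μ.real B ^ k := fun k =>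
    mul_nonneg (by positivity) (pow_nonneg measureReal_nonneg k)
  rw [← hs.tsum_eq, ENNReal.ofReal_tsum_of_nonneg hnn hs.summable]
  exact tsum_congr fun k => (ENNReal.ofReal_mul (by positivity)).symm

theorem noEdge_eq_pi (R : leaves b n → leaves b n → Prop) : noEdge R =
    Set.pi Set.univ fun x => {p | ∀ i < p.1, p.2 i ∈ {X | ∀ y ∈ {y | R x y}, ¬EndsAt X y}} := by
  ext ω
  simp [noEdge, Set.mem_pi]

theorem measurableSet_noEdge (R : leaves b n → leaves b n → Prop) : MeasurableSet (noEdge R) := by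
  rw [noEdge_eq_pi]
  exact MeasurableSet.univ_pi fun x => (poisson_prod_infinitePi_apply (walkLaw (tree b n) x.1) 0
    (measurableSet_forall_not_endsAt _)).1

instance (l : ℝ) : IsProbabilityMeasure (law b n l) := by
  unfold law
  infer_instance

/-- Leaves are independent and each contributes a thinned Poisson void probability. The half in the
mean l / 2 is the half in `rate`. -/
theorem law_noEdge {l : ℝ} (hl : 0 ≤ l) (R : leaves b n → leaves b n → Prop) :
    law b n l (noEdge R) = ENNReal.ofReal (Real.exp (-(l * rate R))) := by
  classical
  rw [noEdge_eq_pi, law, Measure.pi_pi]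
  have : ∀ x : leaves b n, ((poissonMeasure (l / 2).toNNReal).prod
      (Measure.infinitePi fun _ : ℕ => walkLaw (tree b n) x.1))
        {p | ∀ i < p.1, p.2 i ∈ {X | ∀ y ∈ {y | R x y}, ¬EndsAt X y}} =
      ENNReal.ofReal (Real.exp (-(l / 2 * ∑ y, if R x y then returnProb x y else 0))) := by
    intro x
    rw [(poisson_prod_infinitePi_apply _ _ (measurableSet_forall_not_endsAt _)).2]
    have h := measureReal_forall_not_endsAt x (Finset.univ.filter fun y => R x y)
    simp only [Finset.mem_filter, Finset.mem_univ, true_and] at h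
    simp only [Set.mem_ofPred_eq]
    rw [h, Real.coe_toNNReal _ (by positivity), sub_sub_cancel, Finset.sum_filter]
  simp_rw [this]
  rw [← ENNReal.ofReal_prod_of_nonneg fun x _ => (Real.exp_pos _).le, ← Real.exp_sum,
    Finset.sum_neg_distrib, ← Finset.mul_sum]
  unfold rate
  congr 3
  rw [div_mul_eq_mul_div, mul_div_assoc]

theorem measureReal_noEdge {l : ℝ} (hl : 0 ≤ l) (R : leaves b n → leaves b n → Prop) :
    (law b n l).real (noEdge R) = Real.exp (-(l * rate R)) := by
  rw [measureReal_def, law_noEdge hl, ENNReal.toReal_ofReal (Real.exp_pos _).le]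

end Law

/-! ### Connectedness and cuts -/

section Cut

variable {b n : ℕ}

theorem not_connected_of_noEdge {ω : Outcome b n} {S : Set (leaves b n)} (hS : S.Nonempty)
    (hS' : S ≠ Set.univ) (hω : ω ∈ noEdge (Cuts S)) : ω ∈ (connectedEvent b n)ᶜ := by
  intro hc
  obtain ⟨x, hx⟩ := hS
  obtain ⟨y, hy⟩ := (Set.ne_univ_iff_exists_notMem S).1 hS'
  have hadj : ∀ u v, (multigraph ω).Adj u v → (u ∈ S ↔ v ∈ S) := by
    rintro u v ⟨⟨p, i⟩, hi, z, hz, he⟩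
    have h1 : p ∈ S ↔ z ∈ S := not_not.1 fun h => hω p i hi z h hz
    rcases Sym2.eq_iff.1 he with ⟨rfl, rfl⟩ | ⟨rfl, rfl⟩
    exacts [h1, h1.symm]
  have hadj' : ∀ u v, (SimpleGraph.fromRel (multigraph ω).Adj).Adj u v → (u ∈ S ↔ v ∈ S) := by
    intro u v h
    rcases ((SimpleGraph.fromRel_adj _ _ _).1 h).2 with h | h
    exacts [hadj u v h, (hadj v u h).symm]
  have hreach : ∀ u v, (SimpleGraph.fromRel (multigraph ω).Adj).Reachable u v →
      (u ∈ S ↔ v ∈ S) := by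
    rintro u v ⟨p⟩
    induction p with
    | nil => rfl
    | cons h p ih => exact (hadj' _ _ h).trans ih
  exact hy ((hreach x y (hc.preconnected x y)).1 hx)

theorem exists_noEdge_of_not_connected [Nonempty (leaves b n)] {ω : Outcome b n}
    (hω : ω ∈ (connectedEvent b n)ᶜ) :
    ∃ S : Set (leaves b n), S.Nonempty ∧ S ≠ Set.univ ∧ ω ∈ noEdge (Cuts S) := by
  have h1 : ¬(SimpleGraph.fromRel (multigraph ω).Adj).Preconnected := fun h => hω ⟨h⟩
  simp only [SimpleGraph.Preconnected, not_forall] at h1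
  obtain ⟨x, y, hxy⟩ := h1
  -- The cut is the connected component of `x`.
  refine ⟨{z | (SimpleGraph.fromRel (multigraph ω).Adj).Reachable x z}, ⟨x, .refl x⟩,
    fun h => hxy (Set.eq_univ_iff_forall.1 h y), fun u i hi v huv hend => huv ?_⟩
  have hadj : (multigraph ω).Adj u v := ⟨(u, i), hi, v, hend, rfl⟩
  have hr : (SimpleGraph.fromRel (multigraph ω).Adj).Reachable u v := by
    rcases eq_or_ne u v with rfl | hne
    · exact .refl u
    · exact SimpleGraph.Adj.reachable ((SimpleGraph.fromRel_adj _ _ _).2 ⟨hne, Or.inl hadj⟩)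
  exact ⟨fun h => h.trans hr, fun h => h.trans hr.symm⟩

end Cut

/-! ### Cuts as configurations -/

section ConfigOf

variable {b n : ℕ}

/-- The configuration of a predicate on the leaves of the subtree of height `h` below `w`. -/
def configOf (p : List (Fin b) → Bool) : (h : ℕ) → List (Fin b) → Config b h
  | 0, w => .leaf (p w)
  | h + 1, w => .node fun a => configOf p h (a :: w)

theorem configOf_not (p : List (Fin b) → Bool) :
    ∀ (h : ℕ) (w : List (Fin b)), configOf (fun l => !p l) h w = (configOf p h w).compl
  | 0, _ => rfl
  | h + 1, w => congrArg Config.node (funext fun a => configOf_not p h (a :: w))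

theorem configOf_congr_iff {p q : List (Fin b) → Bool} :
    ∀ {h : ℕ} {w : List (Fin b)}, configOf p h w = configOf q h w ↔
      ∀ l : List (Fin b), l.length = h → p (l ++ w) = q (l ++ w)
  | 0, w => by
    simp [configOf]
  | h + 1, w => by
    simp only [configOf, Config.node.injEq, funext_iff, configOf_congr_iff (h := h)]
    constructor
    · intro H l hl
      have hne : l ≠ [] := by rintro rfl; simp at hl
      have h1 := H (l.getLast hne) l.dropLast (by simp [hl])
      rwa [← List.singleton_append, ← List.append_assoc, List.dropLast_append_getLast] at h1
    · intro H a l hl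
      have h1 := H (l ++ [a]) (by simp [hl])
      simpa using h1

theorem density_configOf (p : List (Fin b) → Bool) : ∀ (h : ℕ) (w : List (Fin b)),
    (configOf p h w).density = leafMean (fun l => if p l then 1 else 0) h w
  | 0, _ => rfl
  | h + 1, w => by
    rw [configOf, Config.density_node, leafMean]
    simp_rw [density_configOf p h]

/-- The capacity of a half-infinite branch of the tree, seen from its boundary. -/
def capacity (b : ℕ) : ℝ := ((b : ℝ) - 1) / (b + 1)

theorem capacity_pos (hb : 2 ≤ b) : 0 < capacity b := by
  have : (2 : ℝ) ≤ b := by exact_mod_cast hb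
  unfold capacity
  apply div_pos <;> linarith

/-- The infinite-tree value (b - 1)/b times a finite-height correction. The correction is at least
1, so it may be dropped in lower bounds on rates, and it tends to 1 geometrically, which keeps the
rate of a block close to the capacity. -/
theorem one_sub_upRatio (hb : 2 ≤ b) (h : ℕ) :
    1 - upRatio b h = ((b : ℝ) - 1) / b * (1 - ((b : ℝ) ^ (h + 1))⁻¹)⁻¹ := by
  have hb' : (2 : ℝ) ≤ b := by exact_mod_cast hb
  have h1 : (1 : ℝ) < (b : ℝ) ^ (h + 1) := one_lt_pow₀ (by linarith) (by lia)
  have h2 : (b : ℝ) ^ (h + 1) - 1 ≠ 0 := by linarith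
  have h3 : (b : ℝ) ^ (h + 1) ≠ 0 := by linarith
  have h4 : 1 - ((b : ℝ) ^ (h + 1))⁻¹ = ((b : ℝ) ^ (h + 1) - 1) / (b : ℝ) ^ (h + 1) := by
    field_simp
  rw [h4, inv_div, upRatio, one_sub_div h2, div_mul_div_comm, pow_succ]
  have h5 : (b : ℝ) ^ h * b - 1 ≠ 0 := by rwa [← pow_succ]
  rw [div_eq_div_iff h5 (mul_ne_zero (by linarith) h5)]
  ring

theorem le_one_sub_upRatio (hb : 2 ≤ b) (h : ℕ) : ((b : ℝ) - 1) / b ≤ 1 - upRatio b h := by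
  have hb' : (2 : ℝ) ≤ b := by exact_mod_cast hb
  rw [one_sub_upRatio hb]
  have h1 : (1 : ℝ) < (b : ℝ) ^ (h + 1) := one_lt_pow₀ (by linarith) (by lia)
  have h2 := inv_lt_one_of_one_lt₀ h1
  have h3 : (0 : ℝ) < ((b : ℝ) ^ (h + 1))⁻¹ := by positivity
  refine le_mul_of_one_le_right (div_nonneg (by linarith) (by linarith)) ?_
  exact (one_le_inv₀ (by linarith)).2 (by linarith)

/-- The Dirichlet energy dominates the normalised energy corrected for the root. -/
theorem capacity_mul_le_leafEnergy (hb : 2 ≤ b) (p : List (Fin b) → Bool) :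
    ∀ (h : ℕ) (w : List (Fin b)),
      capacity b * ((configOf p h w).energy - (configOf p h w).density ^ 2) ≤
        leafEnergy (fun l => if p l then 1 else 0) h w
  | 0, w => by
    cases hp : p w <;> simp [configOf, hp, Config.energy, Config.density, leafEnergy]
  | h + 1, w => by
    have hb' : (2 : ℝ) ≤ b := by exact_mod_cast hb
    set f : List (Fin b) → ℝ := fun l => if p l then 1 else 0 with hf
    have h1 := Finset.sum_le_sum fun a (_ : a ∈ Finset.univ) =>
      capacity_mul_le_leafEnergy hb p h (a :: w)
    rw [leafEnergy]
    set d : Fin b → ℝ := fun a => leafMean f h (a :: w) with hd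
    have hdens : ∀ a, (configOf p h (a :: w)).density = d a := fun a =>
      density_configOf p h (a :: w)
    set s := ∑ a, d a with hs
    have hmean : leafMean f (h + 1) w = s / b := rfl
    have hD : ∑ a, (d a - s / b) ^ 2 = ∑ a, d a ^ 2 - s ^ 2 / b := by
      simp_rw [sub_sq, Finset.sum_add_distrib, Finset.sum_sub_distrib, ← Finset.sum_mul,
        ← Finset.mul_sum, ← hs]
      simp only [Finset.sum_const, Finset.card_univ, Fintype.card_fin, nsmul_eq_mul]
      field_simp
      ring
    have h2 : ((b : ℝ) - 1) / b * ∑ a, (d a - s / b) ^ 2 ≤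
        (1 - upRatio b h) * ∑ a, (d a - s / b) ^ 2 :=
      mul_le_mul_of_nonneg_right (le_one_sub_upRatio hb h)
        (Finset.sum_nonneg fun a _ => sq_nonneg _)
    have h3 : capacity b * ((configOf p (h + 1) w).energy - (configOf p (h + 1) w).density ^ 2) =
        ∑ a, capacity b * ((configOf p h (a :: w)).energy - d a ^ 2) +
          ((b : ℝ) - 1) / b * (∑ a, d a ^ 2 - s ^ 2 / b) := by
      rw [configOf, Config.energy_node, Config.density_node]
      simp_rw [hdens]
      rw [← hs, ← Finset.mul_sum, Finset.sum_sub_distrib]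
      unfold capacity
      field_simp
      ring
    rw [h3, hmean, ← hD]
    simp_rw [hdens] at h1
    exact add_le_add h1 h2

/-- The set of words of the leaves in `S`. -/
def leafPred (S : Set (leaves b n)) (l : List (Fin b)) : Bool :=
  open Classical in decide (∃ x ∈ S, x.1.1 = l)

/-- A set of leaves as a configuration. -/
def config (S : Set (leaves b n)) : Config b n := configOf (leafPred S) n []

theorem leafPred_apply (S : Set (leaves b n)) (x : leaves b n) :
    leafPred S x.1.1 = true ↔ x ∈ S := by
  simp only [leafPred, decide_eq_true_eq]
  exact ⟨fun ⟨y, hy, h⟩ => Subtype.ext (Subtype.ext h) ▸ hy, fun h => ⟨x, h, rfl⟩⟩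

theorem config_eq_iff {S : Set (leaves b n)} {p : List (Fin b) → Bool} :
    config S = configOf p n [] ↔ ∀ x : leaves b n, p x.1.1 = true ↔ x ∈ S := by
  rw [config, configOf_congr_iff]
  constructor
  · intro H x
    have := H x.1.1 x.2
    rw [List.append_nil] at this
    rw [← this, leafPred_apply]
  · intro H l hl
    have := H ⟨⟨l, hl.le⟩, hl⟩
    rw [List.append_nil, Bool.eq_iff_iff, this]
    exact leafPred_apply S ⟨⟨l, hl.le⟩, hl⟩

theorem config_injective : Function.Injective (config : Set (leaves b n) → Config b n) := by
  intro S S' h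
  ext x
  rw [← config_eq_iff.1 h x, leafPred_apply]

theorem config_compl (S : Set (leaves b n)) : config Sᶜ = (config S).compl := by
  rw [show (config S).compl = _ from (configOf_not (leafPred S) n []).symm]
  refine config_eq_iff.2 fun x => ?_
  rw [Set.mem_compl_iff, ← leafPred_apply S x]
  simp

theorem config_empty_density : (config (∅ : Set (leaves b n))).density = 0 := by
  have h1 : ∀ (h : ℕ) (w : List (Fin b)), (configOf (fun _ => false) h w).density = 0 := by
    intro h
    induction h with
    | zero => intro w; simp [configOf, Config.density]
    | succ h ih => intro w; rw [configOf, Config.density_node]; simp [ih]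
  rw [(config_eq_iff (p := fun _ => false)).2 (by simp)]
  exact h1 n []

theorem config_density_ne_zero (hb : b ≠ 0) {S : Set (leaves b n)} (hS : S.Nonempty) :
    (config S).density ≠ 0 := fun h =>
  hS.ne_empty (config_injective (Config.eq_of_density_eq_zero hb h config_empty_density))

theorem cuts_compl (S : Set (leaves b n)) : Cuts Sᶜ = Cuts S := by
  ext x y
  simp [Cuts, not_iff_not]

theorem leafIndicator_eq (S : Set (leaves b n)) :
    leafIndicator S = fun l => if leafPred S l then 1 else 0 := by
  ext l
  unfold leafIndicator
  by_cases h : ∃ x ∈ S, x.1.1 = l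
  · rw [if_pos h, if_pos (by simpa [leafPred] using h)]
  · rw [if_neg h, if_neg (by simpa [leafPred] using h)]

theorem capacity_mul_le_rate (hb : 2 ≤ b) (hn : n ≠ 0) (S : Set (leaves b n)) :
    capacity b * ((config S).energy - (config S).density ^ 2) ≤ rate (Cuts S) := by
  rw [rate_cuts hb hn, leafIndicator_eq]
  exact capacity_mul_le_leafEnergy hb (leafPred S) n []

theorem nonempty_leaves (hb : b ≠ 0) : Nonempty (leaves b n) := by
  have : NeZero b := ⟨hb⟩
  exact ⟨⟨⟨List.replicate n 0, by simp⟩, List.length_replicate⟩⟩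

/-- The union bound over all cuts. -/
theorem law_not_connected_le (hb : 2 ≤ b) (hn : n ≠ 0) {l : ℝ} (hl : 0 ≤ l) :
    law b n l (connectedEvent b n)ᶜ ≤
      ENNReal.ofReal (Config.errorTerm b (l * capacity b) n *
        Config.partitionSum b (l * capacity b) n) := by
  classical
  have hb0 : b ≠ 0 := by lia
  have := nonempty_leaves (n := n) hb0
  have hc := (capacity_pos hb).le
  -- A cut and its complement give the same event, so the side of density at most 1/2 suffices.
  set good : Finset (Set (leaves b n)) :=
    Finset.univ.filter fun S => (config S).density ≠ 0 ∧ (config S).density ≤ 1 / 2 with hgood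
  have hsub : (connectedEvent b n)ᶜ ⊆ ⋃ S ∈ good, noEdge (Cuts S) := by
    intro ω hω
    obtain ⟨S, hS, hS', h⟩ := exists_noEdge_of_not_connected hω
    rw [Set.mem_iUnion₂]
    rcases le_total (config S).density (1 / 2) with hd | hd
    · exact ⟨S, by simp only [hgood, Finset.mem_filter, Finset.mem_univ, true_and]; exact
        ⟨config_density_ne_zero hb0 hS, hd⟩, h⟩
    · refine ⟨Sᶜ, ?_, by rwa [cuts_compl]⟩
      simp only [hgood, Finset.mem_filter, Finset.mem_univ, true_and]
      refine ⟨config_density_ne_zero hb0 (Set.nonempty_compl.2 hS'), ?_⟩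
      rw [config_compl, Config.density_compl hb0]
      linarith
  refine (measure_mono hsub).trans ((measure_biUnion_finset_le _ _).trans ?_)
  simp_rw [law_noEdge hl]
  rw [← ENNReal.ofReal_sum_of_nonneg fun S _ => (Real.exp_pos _).le]
  refine ENNReal.ofReal_le_ofReal (le_trans ?_ (Config.sum_exp_neg_energy_le hb0
    (mul_nonneg hl hc) n))
  set F : Config b n → ℝ := fun c => if c.density ≠ 0 ∧ c.density ≤ 1 / 2 then
      Real.exp (-(l * capacity b * (c.energy - c.density ^ 2))) else 0 with hF
  have hF0 : ∀ c, 0 ≤ F c := fun c => by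
    rw [hF]; dsimp only; split_ifs
    exacts [(Real.exp_pos _).le, le_rfl]
  calc ∑ S ∈ good, Real.exp (-(l * rate (Cuts S))) ≤ ∑ S ∈ good, F (config S) := by
        refine Finset.sum_le_sum fun S hS => ?_
        rw [hF]
        dsimp only
        rw [if_pos (Finset.mem_filter.1 hS).2]
        apply Real.exp_le_exp.2
        have := mul_le_mul_of_nonneg_left (capacity_mul_le_rate hb hn S) hl
        linarith
    _ = ∑ c ∈ good.image config, F c :=
        (Finset.sum_image fun S _ S' _ h => config_injective h).symm
    _ ≤ ∑ c, F c := Finset.sum_le_sum_of_subset_of_nonneg (Finset.subset_univ _) fun c _ _ => hF0 c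

end ConfigOf

/-! ### The connected regime -/

section Supercritical

variable {b : ℕ}

/-- This is what makes the constant critical: at l = `sigmaCrit b * n` the factor exp(-l * capacity)
is b^{-n}, the inverse of the number of leaves. -/
theorem sigmaCrit_mul_capacity (hb : 2 ≤ b) : sigmaCrit b * capacity b = Real.log b := by
  have : (2 : ℝ) ≤ b := by exact_mod_cast hb
  have h1 : (b : ℝ) - 1 ≠ 0 := by linarith
  unfold sigmaCrit capacity
  field_simp

theorem sum_errorTerm_le (hb : 2 ≤ b) (L : ℝ) (n : ℕ) :
    ∑ k ∈ Finset.range (n + 1), Config.errorTerm b L k ≤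
      2 * Real.exp 2 * (b ^ n * Real.exp (-L)) + (n + 1) * (L * Real.exp (-(L / 4))) := by
  have hb' : (2 : ℝ) ≤ b := by exact_mod_cast hb
  have hgeom : ∀ m : ℕ, ∑ k ∈ Finset.range (m + 1), (b : ℝ) ^ k ≤ 2 * b ^ m := by
    intro m
    induction m with
    | zero => norm_num
    | succ m ih =>
      rw [Finset.sum_range_succ, pow_succ]
      have : (0 : ℝ) ≤ (b : ℝ) ^ m := by positivity
      nlinarith
  unfold Config.errorTerm
  rw [Finset.sum_add_distrib, ← Finset.sum_mul, ← Finset.mul_sum]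
  simp only [Finset.sum_const, Finset.card_range, nsmul_eq_mul]
  push_cast
  have h1 := mul_le_mul_of_nonneg_left (hgeom n) (mul_pos (Real.exp_pos 2) (Real.exp_pos (-L))).le
  linarith

/-- With `L = n log b + a log n` and `a > b - 1`, the error terms are summable with room to
spare. -/
theorem tendsto_pow_mul_sum_errorTerm (hb : 2 ≤ b) {a : ℝ} (ha : (b : ℝ) - 1 < a) :
    Tendsto (fun n : ℕ => (n : ℝ) ^ (b - 1) *
      ∑ k ∈ Finset.range (n + 1), Config.errorTerm b (n * Real.log b + a * Real.log n) k)
      atTop (𝓝 0) := by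
  have hb' : (2 : ℝ) ≤ b := by exact_mod_cast hb
  have hlog : 0 < Real.log b := Real.log_pos (by linarith)
  set K := Real.log b + a with hK
  have hlim1 : Tendsto (fun n : ℕ => 2 * Real.exp 2 * (n : ℝ) ^ (-(a - (b - 1))))
      atTop (𝓝 0) := by
    simpa using ((tendsto_rpow_neg_atTop (sub_pos.2 ha)).comp
      tendsto_natCast_atTop_atTop).const_mul (2 * Real.exp 2)
  have hlim2 : Tendsto (fun n : ℕ => 2 * K * ((n : ℝ) ^ (b + 1) *
      Real.exp (-(Real.log b / 4)) ^ n)) atTop (𝓝 0) := by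
    have := tendsto_pow_const_mul_const_pow_of_abs_lt_one (b + 1)
      (r := Real.exp (-(Real.log b / 4)))
      (by rw [abs_of_pos (Real.exp_pos _)]; exact Real.exp_lt_one_iff.2 (by linarith))
    simpa using this.const_mul (2 * K)
  refine tendsto_of_tendsto_of_tendsto_of_le_of_le' tendsto_const_nhds
    (by simpa using hlim1.add hlim2) ?_ ?_
  · filter_upwards [eventually_ge_atTop 1] with n hn
    have hn1 : (1 : ℝ) ≤ n := by exact_mod_cast hn
    have hlogn := Real.log_nonneg hn1
    refine mul_nonneg (by positivity) (Finset.sum_nonneg fun k _ => Config.errorTerm_nonneg ?_ k)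
    have : 0 ≤ a := by linarith
    positivity
  · filter_upwards [eventually_ge_atTop 1] with n hn
    have hn1 : (1 : ℝ) ≤ n := by exact_mod_cast hn
    have hn0 : (0 : ℝ) < n := by linarith
    have hlogn := Real.log_nonneg hn1
    have ha0 : 0 ≤ a := by linarith
    set L := n * Real.log b + a * Real.log n with hL
    have hpow : (n : ℝ) ^ (b - 1) = (n : ℝ) ^ ((b : ℝ) - 1) := by
      rw [← Real.rpow_natCast, Nat.cast_pred (by lia)]
    -- The leading term of L cancels b^n exactly; the remaining n^{-a} beats n^{b-1} because a > b -
    -- 1.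
    have h1 : (b : ℝ) ^ n * Real.exp (-L) = (n : ℝ) ^ (-a) := by
      rw [← Real.rpow_natCast, Real.rpow_def_of_pos (by linarith), Real.rpow_def_of_pos hn0,
        ← Real.exp_add]
      congr 1
      rw [hL]
      ring
    have h2 : L ≤ K * n := by
      have : Real.log n ≤ n := (Real.log_le_sub_one_of_pos hn0).trans (by linarith)
      nlinarith
    have h3 : Real.exp (-(L / 4)) ≤ Real.exp (-(Real.log b / 4)) ^ n := by
      rw [← Real.exp_nat_mul]
      apply Real.exp_le_exp.2
      have : 0 ≤ a * Real.log n := by positivity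
      rw [hL]
      linarith
    have hL0 : 0 ≤ L := by positivity
    have hK0 : 0 ≤ K := by positivity
    calc (n : ℝ) ^ (b - 1) * ∑ k ∈ Finset.range (n + 1), Config.errorTerm b L k
        ≤ (n : ℝ) ^ (b - 1) * (2 * Real.exp 2 * (b ^ n * Real.exp (-L)) +
          (n + 1) * (L * Real.exp (-(L / 4)))) :=
          mul_le_mul_of_nonneg_left (sum_errorTerm_le hb L n) (by positivity)
      _ = 2 * Real.exp 2 * (n : ℝ) ^ (-(a - (b - 1))) +
          (n : ℝ) ^ (b - 1) * ((n + 1) * (L * Real.exp (-(L / 4)))) := by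
          rw [h1, mul_add, hpow, show -(a - ((b : ℝ) - 1)) = ((b : ℝ) - 1) + -a by ring,
            Real.rpow_add hn0]
          ring
      _ ≤ 2 * Real.exp 2 * (n : ℝ) ^ (-(a - (b - 1))) + (n : ℝ) ^ (b - 1) *
          ((2 * n) * ((K * n) * Real.exp (-(Real.log b / 4)) ^ n)) := by
          gcongr
          linarith
      _ = _ := by
          rw [show b + 1 = (b - 1) + 2 by lia, pow_add]
          ring_nf

theorem tendsto_law_not_connected (hb : 2 ≤ b) {α : ℝ} (hα : (b : ℝ) + 1 < α) :
    Tendsto (fun n : ℕ => law b n (sigmaCrit b * n + α * Real.log n) (connectedEvent b n)ᶜ)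
      atTop (𝓝 0) := by
  have hb' : (2 : ℝ) ≤ b := by exact_mod_cast hb
  have hc := capacity_pos hb
  -- Multiplication by the capacity turns the threshold b + 1 into b - 1.
  have ha : (b : ℝ) - 1 < α * capacity b := by
    have : (b : ℝ) - 1 = (b + 1) * capacity b := by
      unfold capacity; field_simp
    rw [this]
    exact mul_lt_mul_of_pos_right hα hc
  have hlim := tendsto_pow_mul_sum_errorTerm hb ha
  set T : ℕ → ℝ := fun n => ∑ k ∈ Finset.range (n + 1),
    Config.errorTerm b (n * Real.log b + α * capacity b * Real.log n) k with hT
  have hlim3 : Tendsto (fun n : ℕ => ENNReal.ofReal (3 * ((n : ℝ) ^ (b - 1) * T n)))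
      atTop (𝓝 0) := by
    simpa using ENNReal.tendsto_ofReal (hlim.const_mul 3)
  refine tendsto_of_tendsto_of_tendsto_of_le_of_le' tendsto_const_nhds hlim3
    (Eventually.of_forall fun _ => zero_le) ?_
  -- Since 2n + 2 ≤ 4n, the factor 3(2n + 2)^b is at most 3 · 4^b · n · n^{b-1}, so this threshold
  -- is exactly what `partitionSum_le` requires.
  have hsmall : ∀ᶠ n : ℕ in atTop, (n : ℝ) ^ (b - 1) * T n ≤ (3 * 4 ^ b)⁻¹ :=
    hlim.eventually_le_const (by positivity)
  filter_upwards [hsmall, eventually_ge_atTop 1] with n hsm hn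
  have hn1 : (1 : ℝ) ≤ n := by exact_mod_cast hn
  have hlogn := Real.log_nonneg hn1
  have hlogb : 0 < Real.log b := Real.log_pos (by linarith)
  have hα0 : 0 ≤ α := by linarith
  set L := n * Real.log b + α * capacity b * Real.log n with hL
  have hL0 : 0 ≤ L := by positivity
  have hl0 : 0 ≤ sigmaCrit b * n + α * Real.log n := by
    have : 0 ≤ sigmaCrit b :=
      mul_nonneg (div_nonneg (by linarith) (by linarith)) hlogb.le
    positivity
  have hlL : (sigmaCrit b * n + α * Real.log n) * capacity b = L := by
    rw [hL, ← sigmaCrit_mul_capacity hb]; ring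
  have hε0 : ∀ k, 0 ≤ Config.errorTerm b L k := Config.errorTerm_nonneg hL0
  have hεT : Config.errorTerm b L n ≤ T n :=
    Finset.single_le_sum (fun k _ => hε0 k) (Finset.mem_range.2 (Nat.lt_succ_self n))
  have hT0 : 0 ≤ T n := (hε0 n).trans hεT
  have hnpow : (n : ℝ) ≤ (n : ℝ) ^ (b - 1) := le_self_pow₀ hn1 (by lia)
  have hTn : (n : ℝ) * T n ≤ (n : ℝ) ^ (b - 1) * T n := mul_le_mul_of_nonneg_right hnpow hT0
  have h4 : (1 : ℝ) ≤ 4 ^ b := one_le_pow₀ (by norm_num)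
  have hsm1 : (n : ℝ) ^ (b - 1) * T n ≤ 1 :=
    hsm.trans (inv_le_one_of_one_le₀ (by linarith))
  have hε1 : Config.errorTerm b L n ≤ 1 := by nlinarith
  have hsum : 3 * (2 * n + 2 : ℝ) ^ b * T n ≤ n := by
    have h5 : (2 * n + 2 : ℝ) ^ b ≤ 4 ^ b * (n * (n : ℝ) ^ (b - 1)) := by
      rw [mul_pow_sub_one (by lia), ← mul_pow]
      exact pow_le_pow_left₀ (by positivity) (by linarith) b
    calc 3 * (2 * n + 2 : ℝ) ^ b * T n ≤ 3 * (4 ^ b * (n * (n : ℝ) ^ (b - 1))) * T n := by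
          gcongr
      _ = n * ((3 * 4 ^ b) * ((n : ℝ) ^ (b - 1) * T n)) := by ring
      _ ≤ n * ((3 * 4 ^ b) * (3 * 4 ^ b)⁻¹) := by gcongr
      _ = n := by rw [mul_inv_cancel₀ (by positivity), mul_one]
  have hZ := Config.partitionSum_le (by lia) hL0 hε1 hsum
  refine (law_not_connected_le hb (by lia) hl0).trans (ENNReal.ofReal_le_ofReal ?_)
  rw [hlL]
  have hZ0 := Config.partitionSum_nonneg (b := b) L n
  calc Config.errorTerm b L n * Config.partitionSum b L n ≤ T n * (3 * n) := by
        gcongr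
        linarith
    _ ≤ _ := by linarith

end Supercritical

/-- Subadditivity suffices, so the events need not be shown measurable. -/
theorem tendsto_measure_one_of_compl {ι : ℕ → Type*} [∀ n, MeasurableSpace (ι n)]
    {μ : ∀ n, Measure (ι n)} [∀ n, IsProbabilityMeasure (μ n)] {A : ∀ n, Set (ι n)}
    (h : Tendsto (fun n => μ n (A n)ᶜ) atTop (𝓝 0)) :
    Tendsto (fun n => μ n (A n)) atTop (𝓝 1) := by
  have h1 : Tendsto (fun n => 1 - μ n (A n)ᶜ) atTop (𝓝 1) := by
    simpa using ENNReal.Tendsto.sub (tendsto_const_nhds (x := (1 : ENNReal))) h (by simp)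
  refine tendsto_of_tendsto_of_tendsto_of_le_of_le h1 tendsto_const_nhds (fun n => ?_)
    fun n => prob_le_one
  rw [tsub_le_iff_right, ← measure_univ (μ := μ n), ← Set.union_compl_self (A n)]
  exact measure_union_le _ _

/-! ### Isolated subtrees -/

section Block

variable {b n : ℕ}

theorem leafMean_leafEnergy_const {f : List (Fin b) → ℝ} {r : ℝ} (hb : b ≠ 0) :
    ∀ {h : ℕ} {w : List (Fin b)}, (∀ l : List (Fin b), l.length = h → f (l ++ w) = r) →
      leafMean f h w = r ∧ leafEnergy f h w = 0
  | 0, w, H => ⟨H [] rfl, rfl⟩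
  | h + 1, w, H => by
    have hb' : (b : ℝ) ≠ 0 := Nat.cast_ne_zero.2 hb
    have h1 : ∀ a, leafMean f h (a :: w) = r ∧ leafEnergy f h (a :: w) = 0 := fun a =>
      leafMean_leafEnergy_const hb fun l hl => by
        have := H (l ++ [a]) (by simp [hl])
        simpa using this
    have h2 : leafMean f (h + 1) w = r := by
      rw [leafMean]
      simp only [fun a => (h1 a).1, Finset.sum_const, Finset.card_univ, Fintype.card_fin,
        nsmul_eq_mul]
      field_simp
    refine ⟨h2, ?_⟩
    rw [leafEnergy, h2]
    simp [fun a => (h1 a).1, fun a => (h1 a).2]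

/-- The energy of a subtree of height `h` in its ancestor at distance `j`. -/
def blockEnergy (b h : ℕ) : ℕ → ℝ
  | 0 => 0
  | j + 1 => blockEnergy b h j +
      (1 - upRatio b (h + j)) * (((b : ℝ) ^ j)⁻¹ ^ 2 * (1 - (b : ℝ)⁻¹))

/-- Without the finite-height corrections the levels telescope to capacity * (1 - b^{-2j}). The
correction decreases with height, so its value at the lowest level bounds them all. -/
theorem blockEnergy_le (hb : 2 ≤ b) (h : ℕ) : ∀ j, blockEnergy b h j ≤
    capacity b * (1 - ((b : ℝ) ^ (h + 1))⁻¹)⁻¹ * (1 - ((b : ℝ) ^ j)⁻¹ ^ 2)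
  | 0 => by simp [blockEnergy]
  | j + 1 => by
    have hb' : (2 : ℝ) ≤ b := by exact_mod_cast hb
    have ih := blockEnergy_le hb h j
    have h1 : (1 : ℝ) < (b : ℝ) ^ (h + 1) := one_lt_pow₀ (by linarith) (by lia)
    have h2 := inv_lt_one_of_one_lt₀ h1
    have h3 : 1 - upRatio b (h + j) ≤
        ((b : ℝ) - 1) / b * (1 - ((b : ℝ) ^ (h + 1))⁻¹)⁻¹ := by
      rw [one_sub_upRatio hb]
      refine mul_le_mul_of_nonneg_left (inv_anti₀ (by linarith) ?_)
        (div_nonneg (by linarith) (by linarith))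
      have : (b : ℝ) ^ (h + 1) ≤ (b : ℝ) ^ (h + j + 1) :=
        pow_le_pow_right₀ (by linarith) (by lia)
      have := inv_anti₀ (by linarith) this
      linarith
    have h4 : (0 : ℝ) ≤ ((b : ℝ) ^ j)⁻¹ ^ 2 * (1 - (b : ℝ)⁻¹) := by
      have := inv_le_one_of_one_le₀ (by linarith : (1 : ℝ) ≤ b)
      exact mul_nonneg (by positivity) (by linarith)
    have h5 := mul_le_mul_of_nonneg_right h3 h4
    have h6 : capacity b * (1 - ((b : ℝ) ^ (h + 1))⁻¹)⁻¹ * (1 - ((b : ℝ) ^ (j + 1))⁻¹ ^ 2) =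
        capacity b * (1 - ((b : ℝ) ^ (h + 1))⁻¹)⁻¹ * (1 - ((b : ℝ) ^ j)⁻¹ ^ 2) +
          ((b : ℝ) - 1) / b * (1 - ((b : ℝ) ^ (h + 1))⁻¹)⁻¹ *
            (((b : ℝ) ^ j)⁻¹ ^ 2 * (1 - (b : ℝ)⁻¹)) := by
      rw [pow_succ _ j, mul_inv]
      generalize (1 - ((b : ℝ) ^ (h + 1))⁻¹)⁻¹ = κ
      generalize ((b : ℝ) ^ j)⁻¹ = t
      unfold capacity
      field_simp
      ring
    rw [blockEnergy, h6]
    exact add_le_add ih h5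

/-- The indicator of a subtree has the mean and the energy of a block. -/
theorem leafMean_leafEnergy_block (hb : b ≠ 0) {f : List (Fin b) → ℝ} {h : ℕ}
    {w : List (Fin b)} (hf : ∀ l : List (Fin b), l.length = h + w.length →
      f l = if l.drop h = w then 1 else 0) :
    ∀ (l u : List (Fin b)), l ++ u = w → leafMean f (h + l.length) u = ((b : ℝ) ^ l.length)⁻¹ ∧
      leafEnergy f (h + l.length) u = blockEnergy b h l.length := by
  intro l
  -- Words run from the block's apex up to the root, so extending `l` at its end moves `u` one step
  -- towards the root.
  induction l using List.reverseRecOn with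
  | nil =>
    intro u hu
    rw [List.nil_append] at hu
    subst hu
    have := leafMean_leafEnergy_const (f := f) (r := 1) hb (h := h) (w := u) fun l hl => by
      rw [hf _ (by simp [hl]), if_pos]
      rw [← hl, List.drop_left]
    simpa [blockEnergy] using this
  | append_singleton l a ih =>
    intro u hu
    have hb' : (b : ℝ) ≠ 0 := Nat.cast_ne_zero.2 hb
    rw [List.append_assoc, List.singleton_append] at hu
    obtain ⟨ih1, ih2⟩ := ih (a :: u) hu
    have hother : ∀ a', a' ≠ a → leafMean f (h + l.length) (a' :: u) = 0 ∧
        leafEnergy f (h + l.length) (a' :: u) = 0 := by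
      intro a' ha'
      refine leafMean_leafEnergy_const hb fun m hm => ?_
      rw [hf _ (by rw [← hu]; simp [hm]; lia), if_neg]
      rw [← hu, List.drop_append_of_le_length (by lia)]
      intro he
      have := (List.append_inj he (by simp [hm])).2
      exact ha' (List.cons.inj this).1
    have hlen : (l ++ [a]).length = l.length + 1 := by simp
    rw [hlen, ← add_assoc]
    set d := ((b : ℝ) ^ l.length)⁻¹ with hd
    have hsum : ∑ a', leafMean f (h + l.length) (a' :: u) = d := by
      rw [Finset.sum_eq_single a (fun a' _ ha' => (hother a' ha').1) (by simp), ih1]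
    have hsq : ∑ a', leafMean f (h + l.length) (a' :: u) ^ 2 = d ^ 2 := by
      rw [Finset.sum_eq_single a (fun a' _ ha' => by rw [(hother a' ha').1]; norm_num) (by simp),
        ih1]
    have hmean : leafMean f (h + l.length + 1) u = d / b := by rw [leafMean, hsum]
    refine ⟨?_, ?_⟩
    · rw [hmean, pow_succ, mul_inv, div_eq_mul_inv]
    · rw [leafEnergy, hmean,
        Finset.sum_eq_single a (fun a' _ ha' => (hother a' ha').2) (by simp), ih2, blockEnergy, ← hd]
      congr 2
      simp_rw [sub_sq, Finset.sum_add_distrib, Finset.sum_sub_distrib, ← Finset.sum_mul,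
        ← Finset.mul_sum, hsum, hsq]
      simp only [Finset.sum_const, Finset.card_univ, Fintype.card_fin, nsmul_eq_mul]
      field_simp
      ring

/-- The set of leaves of the subtree of height `h` with apex `w`. -/
def block (b n h : ℕ) (w : List (Fin b)) : Set (leaves b n) := {x | x.1.1.drop h = w}

theorem leafIndicator_block {h : ℕ} {w l : List (Fin b)} (hl : l.length = n) :
    leafIndicator (block b n h w) l = if l.drop h = w then 1 else 0 := by
  classical
  have := leafIndicator_apply (block b n h w) ⟨⟨l, hl.le⟩, hl⟩
  exact this.trans (if_congr Iff.rfl rfl rfl)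

theorem leafMean_block (hb : b ≠ 0) {h : ℕ} {w : List (Fin b)} (hw : h + w.length = n) :
    leafMean (leafIndicator (block b n h w)) n [] = ((b : ℝ) ^ w.length)⁻¹ := by
  have := (leafMean_leafEnergy_block hb (f := leafIndicator (block b n h w)) (h := h) (w := w)
    (fun l hl => leafIndicator_block (hl.trans hw)) w [] (List.append_nil w)).1
  rwa [hw] at this

theorem rate_block (hb : 2 ≤ b) (hn : n ≠ 0) {h : ℕ} {w : List (Fin b)} (hw : h + w.length = n) :
    rate (Cuts (block b n h w)) = blockEnergy b h w.length := by
  have := (leafMean_leafEnergy_block (by lia) (f := leafIndicator (block b n h w)) (h := h) (w := w)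
    (fun l hl => leafIndicator_block (hl.trans hw)) w [] (List.append_nil w)).2
  rwa [hw, ← rate_cuts hb hn] at this

theorem block_nonempty (hb : b ≠ 0) {h : ℕ} {w : List (Fin b)} (hw : h + w.length = n) :
    (block b n h w).Nonempty := by
  have : NeZero b := ⟨hb⟩
  have hlen : (List.replicate h (0 : Fin b) ++ w).length = n := by simpa using hw
  refine ⟨⟨⟨List.replicate h 0 ++ w, hlen.le⟩, hlen⟩, ?_⟩
  change (List.replicate h (0 : Fin b) ++ w).drop h = w
  rw [List.drop_append_of_le_length (by simp)]
  simp

theorem block_disjoint {h : ℕ} {w w' : List (Fin b)} (hww : w ≠ w') :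
    Disjoint (block b n h w) (block b n h w') :=
  Set.disjoint_left.2 fun _ hx hx' => hww (hx.symm.trans hx')

theorem density_config (S : Set (leaves b n)) :
    (config S).density = leafMean (leafIndicator S) n [] := by
  rw [leafIndicator_eq, config, density_configOf]

theorem leafMean_add (f g : List (Fin b) → ℝ) : ∀ (h : ℕ) (w : List (Fin b)),
    leafMean (fun l => f l + g l) h w = leafMean f h w + leafMean g h w
  | 0, _ => rfl
  | h + 1, w => by
    simp_rw [leafMean, leafMean_add f g h, Finset.sum_add_distrib, add_div]

theorem leafIndicator_union {S S' : Set (leaves b n)} (hd : Disjoint S S') :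
    leafIndicator (S ∪ S') = fun l => leafIndicator S l + leafIndicator S' l := by
  ext l
  unfold leafIndicator
  by_cases h1 : ∃ x ∈ S, x.1.1 = l
  · obtain ⟨x, hx, hxl⟩ := h1
    rw [if_pos ⟨x, Or.inl hx, hxl⟩, if_pos ⟨x, hx, hxl⟩, if_neg, add_zero]
    rintro ⟨y, hy, hyl⟩
    exact Set.disjoint_left.1 hd hx (Subtype.ext (Subtype.ext (hyl.trans hxl.symm)) ▸ hy)
  · rw [if_neg h1, zero_add]
    by_cases h2 : ∃ x ∈ S', x.1.1 = l
    · obtain ⟨x, hx, hxl⟩ := h2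
      rw [if_pos ⟨x, Or.inr hx, hxl⟩, if_pos ⟨x, hx, hxl⟩]
    · rw [if_neg h2, if_neg]
      rintro ⟨x, hx | hx, hxl⟩
      exacts [h1 ⟨x, hx, hxl⟩, h2 ⟨x, hx, hxl⟩]

theorem rate_or_add_rate_and (R R' : leaves b n → leaves b n → Prop) :
    rate (fun x y => R x y ∨ R' x y) + rate (fun x y => R x y ∧ R' x y) = rate R + rate R' := by
  unfold rate
  rw [← add_div, ← add_div, ← Finset.sum_add_distrib, ← Finset.sum_add_distrib]
  simp_rw [← Finset.sum_add_distrib]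
  congr 1
  refine Finset.sum_congr rfl fun x _ => Finset.sum_congr rfl fun y _ => ?_
  by_cases h : R x y <;> by_cases h' : R' x y <;> simp [h, h']

theorem rate_nonneg (R : leaves b n → leaves b n → Prop) : 0 ≤ rate R := by
  unfold rate
  refine div_nonneg (Finset.sum_nonneg fun x _ => Finset.sum_nonneg fun y _ => ?_) zero_le_two
  split_ifs
  exacts [returnProb_nonneg x y, le_rfl]

/-- The rate of the edges between two disjoint sets in terms of rates of cuts. -/
theorem rate_cuts_union {S S' : Set (leaves b n)} (hd : Disjoint S S') :
    rate (Cuts (S ∪ S')) + 2 * rate (fun x y => Cuts S x y ∧ Cuts S' x y) =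
      rate (Cuts S) + rate (Cuts S') := by
  unfold rate
  rw [mul_div_assoc', ← add_div, ← add_div, Finset.mul_sum, ← Finset.sum_add_distrib,
    ← Finset.sum_add_distrib]
  simp_rw [Finset.mul_sum, ← Finset.sum_add_distrib]
  congr 1
  refine Finset.sum_congr rfl fun x _ => Finset.sum_congr rfl fun y _ => ?_
  have hx : x ∈ S → x ∉ S' := fun h => Set.disjoint_left.1 hd h
  have hy : y ∈ S → y ∉ S' := fun h => Set.disjoint_left.1 hd h
  by_cases h1 : x ∈ S <;> by_cases h2 : y ∈ S <;> by_cases h3 : x ∈ S' <;>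
    by_cases h4 : y ∈ S' <;> simp_all [Cuts, two_mul]

end Block

/-! ### The second moment method -/

/-- Chebyshev's inequality for the number of events that occur. -/
theorem sq_mul_measureReal_biInter_compl_le {Ω ι : Type*} [MeasurableSpace Ω] [Fintype ι]
    (μ : Measure Ω) [IsProbabilityMeasure μ] {A : ι → Set Ω} (hA : ∀ i, MeasurableSet (A i))
    {p : ℝ} (hp : ∀ i, μ.real (A i) = p) :
    (Fintype.card ι * p) ^ 2 * μ.real (⋂ i, (A i)ᶜ) ≤
      ∑ i, ∑ j, μ.real (A i ∩ A j) - (Fintype.card ι * p) ^ 2 := by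
  set M : ℝ := Fintype.card ι * p with hM
  set X : Ω → ℝ := fun ω => ∑ i, (A i).indicator 1 ω with hX
  have hint : ∀ B : Set Ω, MeasurableSet B → Integrable (B.indicator (1 : Ω → ℝ)) μ := fun B hB =>
    (integrable_const (1 : ℝ)).indicator hB
  have hXX : ∀ ω, X ω * X ω = ∑ i, ∑ j, (A i ∩ A j).indicator (1 : Ω → ℝ) ω := by
    intro ω
    rw [hX]
    dsimp only
    rw [Finset.sum_mul_sum]
    refine Finset.sum_congr rfl fun i _ => Finset.sum_congr rfl fun j _ => ?_
    rw [Set.inter_indicator_one]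
    rfl
  have hXint : Integrable X μ := integrable_finsetSum _ fun i _ => hint _ (hA i)
  have hXXint : Integrable (fun ω => X ω * X ω) μ := by
    simp_rw [hXX]
    exact integrable_finsetSum _ fun i _ => integrable_finsetSum _ fun j _ =>
      hint _ ((hA i).inter (hA j))
  have hEX : ∫ ω, X ω ∂μ = M := by
    rw [hX, integral_finsetSum _ fun i _ => hint _ (hA i)]
    simp_rw [integral_indicator_one (hA _), hp]
    simp [hM]
  have hEXX : ∫ ω, X ω * X ω ∂μ = ∑ i, ∑ j, μ.real (A i ∩ A j) := by
    simp_rw [hXX]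
    rw [integral_finsetSum _ fun i _ => integrable_finsetSum _ fun j _ =>
      hint _ ((hA i).inter (hA j))]
    refine Finset.sum_congr rfl fun i _ => ?_
    rw [integral_finsetSum _ fun j _ => hint _ ((hA i).inter (hA j))]
    exact Finset.sum_congr rfl fun j _ => integral_indicator_one ((hA i).inter (hA j))
  have h1 : ∀ ω, (X ω - M) ^ 2 = X ω * X ω - 2 * M * X ω + M ^ 2 := fun ω => by ring
  have hlin : Integrable (fun ω => X ω * X ω - 2 * M * X ω) μ :=
    hXXint.sub (hXint.const_mul _)
  have hvar : ∫ ω, (X ω - M) ^ 2 ∂μ = ∑ i, ∑ j, μ.real (A i ∩ A j) - M ^ 2 := by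
    simp_rw [h1]
    rw [integral_add hlin (integrable_const _),
      integral_sub hXXint (hXint.const_mul _), integral_const_mul, hEX, hEXX]
    simp
    ring
  have hmB : MeasurableSet (⋂ i, (A i)ᶜ) := MeasurableSet.iInter fun i => (hA i).compl
  rw [← hvar, mul_comm, ← smul_eq_mul, ← integral_indicator_const _ hmB]
  refine integral_mono ((integrable_const _).indicator hmB) ?_ fun ω => ?_
  · simp_rw [h1]
    exact hlin.add (integrable_const _)
  · by_cases hω : ω ∈ ⋂ i, (A i)ᶜ
    · have : X ω = 0 := Finset.sum_eq_zero fun i _ =>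
        Set.indicator_of_notMem (Set.mem_iInter.1 hω i) _
      simp [Set.indicator_of_mem hω, this]
    · rw [Set.indicator_of_notMem hω]
      exact sq_nonneg _

/-! ### Interactions between blocks and the variance bound -/

section Subcritical

variable {b n : ℕ}

theorem noEdge_inter (R R' : leaves b n → leaves b n → Prop) :
    noEdge R ∩ noEdge R' = noEdge fun x y => R x y ∨ R' x y := by
  ext ω
  constructor
  · rintro ⟨h, h'⟩ x i hi y (hR | hR)
    exacts [h x i hi y hR, h' x i hi y hR]
  · exact fun h => ⟨fun x i hi y hR => h x i hi y (Or.inl hR),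
      fun x i hi y hR => h x i hi y (Or.inr hR)⟩

/-- Two distinct blocks interact little. -/
theorem rate_block_and_le (hb : 2 ≤ b) {h k : ℕ} (hk : 2 ≤ k) (hn : h + k = n)
    (hh : (9 : ℝ) ≤ (b : ℝ) ^ (h + 1)) {w w' : List (Fin b)} (hw : w.length = k)
    (hw' : w'.length = k) (hne : w ≠ w') :
    rate (fun x y => Cuts (block b n h w) x y ∧ Cuts (block b n h w') x y) ≤
      3 / 4 * capacity b := by
  have hb' : (2 : ℝ) ≤ b := by exact_mod_cast hb
  have hc := capacity_pos hb
  have hn0 : n ≠ 0 := by lia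
  have hd := block_disjoint (b := b) (n := n) (h := h) hne
  -- The interaction is half of twice the block energy minus the rate of the union. The former
  -- energy is at most 9/8 and the latter rate at least 3/4 of the capacity, giving (9/4 - 3/4)/2 =
  -- 3/4. A constant below 1 is essential: exp(3L/4) must lose to the number of blocks.
  have h1 := rate_cuts_union hd
  rw [rate_block hb hn0 (hw.symm ▸ hn), rate_block hb hn0 (hw'.symm ▸ hn), hw, hw'] at h1
  have h2 := capacity_mul_le_rate hb hn0 (block b n h w ∪ block b n h w')
  have h3 : (config (block b n h w ∪ block b n h w')).density ≤ 1 / 2 := by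
    rw [density_config, leafIndicator_union hd, leafMean_add,
      leafMean_block (by lia) (hw.symm ▸ hn), leafMean_block (by lia) (hw'.symm ▸ hn), hw, hw']
    have : (4 : ℝ) ≤ (b : ℝ) ^ k := by
      calc (4 : ℝ) = 2 ^ 2 := by norm_num
        _ ≤ (b : ℝ) ^ 2 := by gcongr
        _ ≤ (b : ℝ) ^ k := pow_le_pow_right₀ (by linarith) hk
    have := inv_anti₀ (by norm_num) this
    linarith
  have h4 := Config.one_le_energy (by lia) (config_density_ne_zero (b := b) (n := n) (by lia)
    ((block_nonempty (by lia) (hw.symm ▸ hn)).mono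
      (Set.subset_union_left (s := block b n h w) (t := block b n h w'))))
  have h0 := Config.density_nonneg (config (block b n h w ∪ block b n h w'))
  have h5 : capacity b * (3 / 4) ≤ rate (Cuts (block b n h w ∪ block b n h w')) := by
    refine le_trans (mul_le_mul_of_nonneg_left ?_ hc.le) h2
    nlinarith
  have h6 : blockEnergy b h k ≤ capacity b * (9 / 8) := by
    refine (blockEnergy_le hb h k).trans ?_
    have h7 : (1 - ((b : ℝ) ^ (h + 1))⁻¹)⁻¹ ≤ 9 / 8 := by
      have := inv_anti₀ (by norm_num) hh
      refine (inv_anti₀ (by norm_num : (0 : ℝ) < 8 / 9) (by linarith)).trans (by norm_num)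
    have h8 : 0 < (1 - ((b : ℝ) ^ (h + 1))⁻¹)⁻¹ := by
      have := inv_anti₀ (by norm_num) hh
      exact inv_pos.2 (by linarith)
    have h9 : 1 - ((b : ℝ) ^ k)⁻¹ ^ 2 ≤ 1 := by
      have : 0 ≤ ((b : ℝ) ^ k)⁻¹ ^ 2 := by positivity
      linarith
    calc _ ≤ capacity b * (1 - ((b : ℝ) ^ (h + 1))⁻¹)⁻¹ * 1 := by gcongr
      _ ≤ _ := by rw [mul_one]; gcongr
  linarith

/-- The interactions of a block with the other blocks sum to at most the rate of its cut. -/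
theorem sum_rate_block_and_le {h : ℕ} {ι : Type*} [Fintype ι] [DecidableEq ι]
    {w : ι → List (Fin b)} (hw : Function.Injective w) (i : ι) :
    ∑ j ∈ Finset.univ.erase i,
      rate (fun x y => Cuts (block b n h (w i)) x y ∧ Cuts (block b n h (w j)) x y) ≤
        rate (Cuts (block b n h (w i))) := by
  classical
  unfold rate
  rw [← Finset.sum_div, Finset.sum_comm]
  refine div_le_div_of_nonneg_right (Finset.sum_le_sum fun x _ => ?_) zero_le_two
  rw [Finset.sum_comm]
  refine Finset.sum_le_sum fun y _ => ?_
  by_cases hc : Cuts (block b n h (w i)) x y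
  · simp only [hc, true_and, if_true]
    rw [← Finset.sum_filter, Finset.sum_const, nsmul_eq_mul]
    refine mul_le_of_le_one_left (returnProb_nonneg x y) ?_
    norm_cast
    -- A pair leaving block `i` has its other endpoint in at most one further block.
    refine Finset.card_le_one.2 fun j hj j' hj' => hw ?_
    simp only [Finset.mem_filter, Finset.mem_erase, Finset.mem_univ, and_true] at hj hj'
    have h1 : w j ≠ w i := fun h => hj.1 (hw h)
    have h2 : w j' ≠ w i := fun h => hj'.1 (hw h)
    have h3 := hj.2
    have h4 := hj'.2
    simp only [Cuts, block, Set.mem_ofPred_eq] at hc h3 h4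
    grind
  · simp [hc]

/-- The probability that no subtree of height `h` is isolated. -/
theorem law_connected_le (hb : 2 ≤ b) {h k : ℕ} (hk : 2 ≤ k) (hn : h + k = n)
    (hh : (9 : ℝ) ≤ (b : ℝ) ^ (h + 1)) {l : ℝ} (hl : 0 ≤ l) :
    (law b n l).real (connectedEvent b n) ≤
      ((b : ℝ) ^ k * Real.exp (-(l * blockEnergy b h k)))⁻¹ +
        l * blockEnergy b h k * Real.exp (l * (3 / 4 * capacity b)) / (b : ℝ) ^ k := by
  classical
  have hb0 : b ≠ 0 := by lia
  have hn0 : n ≠ 0 := by lia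
  have hbpos : (0 : ℝ) < b := Nat.cast_pos.2 (by lia)
  set E := blockEnergy b h k with hE
  set p := Real.exp (-(l * E)) with hp
  set N := (b : ℝ) ^ k with hN
  set M := Real.exp (l * (3 / 4 * capacity b)) with hM
  set A : List.Vector (Fin b) k → Set (Outcome b n) :=
    fun w => noEdge (Cuts (block b n h w.1)) with hAdef
  have hrate : ∀ w : List.Vector (Fin b) k, rate (Cuts (block b n h w.1)) = E := by
    intro w
    rw [rate_block hb hn0 (by rw [w.2]; exact hn), w.2]
  have hA : ∀ w, MeasurableSet (A w) := fun w => measurableSet_noEdge _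
  have hpA : ∀ w, (law b n l).real (A w) = p := by
    intro w
    rw [hAdef]
    dsimp only
    rw [measureReal_noEdge hl, hrate]
  have hsub : connectedEvent b n ⊆ ⋂ w, (A w)ᶜ := by
    intro ω hω
    rw [Set.mem_iInter]
    intro w hwA
    have hlen : h + w.1.length = n := by rw [w.2]; exact hn
    have hne : ∃ w' : List.Vector (Fin b) k, w ≠ w' := by
      have : Nontrivial (List.Vector (Fin b) k) := by
        rw [← Fintype.one_lt_card_iff_nontrivial, card_vector, Fintype.card_fin]
        exact Nat.one_lt_pow (by lia) (by lia)
      obtain ⟨w', hw'⟩ := exists_ne w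
      exact ⟨w', hw'.symm⟩
    obtain ⟨w', hw'⟩ := hne
    refine not_connected_of_noEdge (block_nonempty hb0 hlen) (fun huniv => ?_) hwA hω
    obtain ⟨x, hx⟩ := block_nonempty (b := b) (n := n) (h := h) (w := w'.1) hb0
      (by rw [w'.2]; exact hn)
    exact Set.disjoint_left.1 (block_disjoint fun h => hw' (Subtype.ext h))
      (huniv ▸ Set.mem_univ x) hx
  have hcheb := sq_mul_measureReal_biInter_compl_le (law b n l) hA hpA
  have hcard : (Fintype.card (List.Vector (Fin b) k) : ℝ) = N := by
    rw [card_vector, Fintype.card_fin, hN]; push_cast; rfl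
  rw [hcard] at hcheb
  have hp0 : 0 < p := Real.exp_pos _
  have hN0 : 0 < N := by positivity
  have hpair : ∀ w w', w ≠ w' → (law b n l).real (A w ∩ A w') ≤ p ^ 2 + p ^ 2 * (l * M *
      rate (fun x y => Cuts (block b n h w.1) x y ∧ Cuts (block b n h w'.1) x y)) := by
    intro w w' hne
    set B := rate (fun x y => Cuts (block b n h w.1) x y ∧ Cuts (block b n h w'.1) x y) with hB
    have hB1 : B ≤ 3 / 4 * capacity b :=
      rate_block_and_le hb hk hn hh w.2 w'.2 fun h => hne (Subtype.ext h)
    have hB0 : 0 ≤ B := rate_nonneg _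
    have h1 := rate_or_add_rate_and (Cuts (block b n h w.1)) (Cuts (block b n h w'.1))
    rw [hrate, hrate, ← hB] at h1
    rw [hAdef]
    dsimp only
    rw [noEdge_inter, measureReal_noEdge hl, eq_sub_of_add_eq h1]
    have h2 : Real.exp (-(l * (E + E - B))) = p ^ 2 * Real.exp (l * B) := by
      rw [hp, ← Real.exp_nat_mul, ← Real.exp_add]
      congr 1
      push_cast
      ring
    -- From e^u ≤ 1 + u e^u, with the last exponential replaced by the uniform bound `M`. The excess
    -- correlation becomes linear in `B` and can be summed over `w'`.
    have h3 : Real.exp (l * B) ≤ 1 + l * M * B := by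
      have h4 : Real.exp (l * B) ≤ M := Real.exp_le_exp.2 (mul_le_mul_of_nonneg_left hB1 hl)
      have h5 : Real.exp (l * B) * (1 - l * B) ≤ 1 := by
        have := Real.add_one_le_exp (-(l * B))
        calc Real.exp (l * B) * (1 - l * B) ≤ Real.exp (l * B) * Real.exp (-(l * B)) := by
              gcongr; linarith
          _ = 1 := by rw [← Real.exp_add, add_neg_cancel, Real.exp_zero]
      have h6 : l * B * Real.exp (l * B) ≤ l * B * M :=
        mul_le_mul_of_nonneg_left h4 (mul_nonneg hl hB0)
      linarith
    rw [h2]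
    calc p ^ 2 * Real.exp (l * B) ≤ p ^ 2 * (1 + l * M * B) := by gcongr
      _ = _ := by ring
  have hrow : ∀ w, ∑ w', (law b n l).real (A w ∩ A w') ≤ p + N * p ^ 2 + p ^ 2 * (l * M * E) := by
    intro w
    rw [← Finset.add_sum_erase _ _ (Finset.mem_univ w), Set.inter_self, hpA]
    have h1 := Finset.sum_le_sum fun w' (hw' : w' ∈ Finset.univ.erase w) =>
      hpair w w' (Finset.ne_of_mem_erase hw').symm
    refine (add_le_add_right h1 p).trans ?_
    rw [Finset.sum_add_distrib, ← Finset.mul_sum, ← Finset.mul_sum, Finset.sum_const, nsmul_eq_mul]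
    have h2 := sum_rate_block_and_le (n := n) (h := h)
      (w := fun w : List.Vector (Fin b) k => w.1) Subtype.val_injective w
    rw [hrate] at h2
    have h3 : ((Finset.univ.erase w).card : ℝ) ≤ N := by
      rw [← hcard]
      exact_mod_cast Finset.card_le_univ _
    have h4 : 0 ≤ l * M := mul_nonneg hl (Real.exp_pos _).le
    have h5 := mul_le_mul_of_nonneg_right h3 (sq_nonneg p)
    have h6 := mul_le_mul_of_nonneg_left (mul_le_mul_of_nonneg_left h2 h4) (sq_nonneg p)
    linarith
  have htotal := Finset.sum_le_sum fun w (_ : w ∈ Finset.univ) => hrow w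
  rw [Finset.sum_const, Finset.card_univ, nsmul_eq_mul, hcard] at htotal
  refine (measureReal_mono hsub).trans ?_
  have hfinal : (N * p) ^ 2 * (law b n l).real (⋂ w, (A w)ᶜ) ≤
      (N * p) ^ 2 * ((N * p)⁻¹ + l * E * M / N) := by
    refine hcheb.trans ((sub_le_sub_right htotal _).trans (le_of_eq ?_))
    field_simp
    ring
  exact le_of_mul_le_mul_left hfinal (by positivity)

end Subcritical

/-! ### Choice of the block height and passage to the limit -/

section SubcriticalLimit

variable {b : ℕ}

/-- Leaves at least two levels above blocks of height about log_b n, as `rate_block_and_le` needs.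
-/
theorem le_two_pow_sub_two {n : ℕ} (hn : 4 ≤ n) : n ≤ 2 ^ (n - 2) := by
  induction n, hn using Nat.le_induction with
  | base => norm_num
  | succ n hn ih =>
    rw [show n + 1 - 2 = (n - 2) + 1 by lia, pow_succ]
    lia

/-- A height `h` with `b ^ h` of order `n`. -/
theorem exists_height (hb : 2 ≤ b) {n : ℕ} (hn : 9 ≤ n) :
    ∃ h k : ℕ, h + k = n ∧ 2 ≤ k ∧ (n : ℝ) ≤ (b : ℝ) ^ h ∧ (b : ℝ) ^ h ≤ b * n := by
  have h1 : n ≤ b ^ Nat.clog b n := Nat.le_pow_clog (by lia) n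
  have h2 : Nat.clog b n ≤ n - 2 :=
    Nat.clog_le_of_le_pow ((le_two_pow_sub_two (by lia)).trans (Nat.pow_le_pow_left hb _))
  have h3 : b ^ (Nat.clog b n - 1) < n := Nat.pow_pred_clog_lt_self (by lia) (by lia)
  have h4 : 0 < Nat.clog b n := Nat.clog_pos (by lia) (by lia)
  refine ⟨Nat.clog b n, n - Nat.clog b n, by lia, by lia, by exact_mod_cast h1, ?_⟩
  have h5 : b ^ Nat.clog b n = b * b ^ (Nat.clog b n - 1) := (mul_pow_sub_one h4.ne' b).symm
  have h6 : b ^ Nat.clog b n ≤ b * n := by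
    rw [h5]
    exact Nat.mul_le_mul_left b h3.le
  exact_mod_cast h6

theorem law_connected_le_of_large (hb : 2 ≤ b) {n : ℕ} (hn : 9 ≤ n) {l γ : ℝ} (hl : 0 ≤ l)
    (hγ : 0 ≤ γ) (hlc : l * capacity b = n * Real.log b - γ * Real.log n) :
    (law b n l).real (connectedEvent b n) ≤ (b : ℝ) ^ 3 * (n : ℝ) ^ (-(γ - 1)) +
      2 * b * Real.log b * ((n : ℝ) ^ 2 * Real.exp (-(Real.log b / 4)) ^ n) := by
  obtain ⟨h, k, hhk, hk, hnh, hhn⟩ := exists_height hb hn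
  have hb' : (2 : ℝ) ≤ b := by exact_mod_cast hb
  have hbpos : (0 : ℝ) < b := by linarith
  have hlog : 0 < Real.log b := Real.log_pos (by linarith)
  have hc := capacity_pos hb
  have hn9 : (9 : ℝ) ≤ n := by exact_mod_cast hn
  have hn0 : (0 : ℝ) < n := by linarith
  have hbh : (n : ℝ) ≤ (b : ℝ) ^ (h + 1) := by
    rw [pow_succ]
    nlinarith
  have h1 := law_connected_le hb hk hhk (hn9.trans hbh) hl
  set E := blockEnergy b h k with hE
  set x := ((b : ℝ) ^ (h + 1))⁻¹ with hx
  have hx0 : 0 < x := by positivity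
  have hxn : n * x ≤ 1 := by
    rw [hx, ← div_eq_mul_inv]
    exact div_le_one_of_le₀ hbh (by positivity)
  have hx9 : x ≤ 1 / 9 := by nlinarith
  have hlc0 : 0 ≤ l * capacity b := mul_nonneg hl hc.le
  have hlcn : l * capacity b ≤ n * Real.log b := by
    have := mul_nonneg hγ (Real.log_nonneg (by linarith : (1 : ℝ) ≤ n))
    linarith
  -- Because x ≤ 1/n, the correction 2x costs at most 2 log b in the exponent l * E, a bounded
  -- factor.
  have hEle : E ≤ capacity b * (1 + 2 * x) := by
    have h2 : (1 - x)⁻¹ ≤ 1 + 2 * x := by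
      rw [inv_le_iff_one_le_mul₀ (by linarith)]
      nlinarith
    have h3 : 1 - ((b : ℝ) ^ k)⁻¹ ^ 2 ≤ 1 := by
      have : 0 ≤ ((b : ℝ) ^ k)⁻¹ ^ 2 := by positivity
      linarith
    have h4 : 0 < (1 - x)⁻¹ := inv_pos.2 (by linarith)
    calc E ≤ capacity b * (1 - x)⁻¹ * (1 - ((b : ℝ) ^ k)⁻¹ ^ 2) := blockEnergy_le hb h k
      _ ≤ capacity b * (1 - x)⁻¹ * 1 := by gcongr
      _ ≤ _ := by rw [mul_one]; gcongr
  have hlE : l * E ≤ l * capacity b + 2 * Real.log b := by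
    have h2 := mul_le_mul_of_nonneg_left hEle hl
    have h3 : l * capacity b * x ≤ n * Real.log b * x := mul_le_mul_of_nonneg_right hlcn hx0.le
    have h4 : n * x * Real.log b ≤ 1 * Real.log b := mul_le_mul_of_nonneg_right hxn hlog.le
    linarith
  have hlE2 : l * E ≤ 2 * (n * Real.log b) := by nlinarith
  have hbn : (b : ℝ) ^ n = Real.exp (n * Real.log b) := by
    rw [Real.exp_nat_mul, Real.exp_log hbpos]
  -- There are fewer blocks than leaves by a factor of at most bn; this loss of one power of n is
  -- why γ must exceed 1.
  have hbk : ((b : ℝ) ^ k)⁻¹ ≤ b * n * Real.exp (-(n * Real.log b)) := by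
    rw [Real.exp_neg, ← hbn, ← hhk, pow_add, mul_inv, ← mul_assoc]
    refine le_mul_of_one_le_left (by positivity) ?_
    rw [← div_eq_mul_inv, one_le_div (by positivity), hhk]
    exact hhn
  refine h1.trans (add_le_add ?_ ?_)
  · rw [mul_inv, ← Real.exp_neg, neg_neg]
    calc ((b : ℝ) ^ k)⁻¹ * Real.exp (l * E)
        ≤ (b * n * Real.exp (-(n * Real.log b))) *
          Real.exp (n * Real.log b - γ * Real.log n + 2 * Real.log b) := by
          gcongr
          rw [← hlc]
          exact hlE
      _ = b * n * (Real.exp (-(γ * Real.log n)) * Real.exp (2 * Real.log b)) := by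
          rw [mul_assoc, ← Real.exp_add, ← Real.exp_add]
          congr 2
          ring
      _ = (b : ℝ) ^ 3 * (n : ℝ) ^ (-(γ - 1)) := by
          have e1 : Real.exp (2 * Real.log b) = (b : ℝ) ^ 2 := by
            have := Real.exp_nat_mul (Real.log b) 2
            rw [Real.exp_log hbpos] at this
            exact_mod_cast this
          have e2 : (n : ℝ) ^ (-(γ - 1)) = Real.exp (-(γ * Real.log n)) * n := by
            rw [Real.rpow_def_of_pos hn0]
            nth_rw 3 [← Real.exp_log hn0]
            rw [← Real.exp_add]
            congr 1
            ring
          rw [e1, e2]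
          ring
  · have hM : Real.exp (l * (3 / 4 * capacity b)) ≤ Real.exp (3 / 4 * (n * Real.log b)) := by
      apply Real.exp_le_exp.2
      linarith
    calc l * E * Real.exp (l * (3 / 4 * capacity b)) / (b : ℝ) ^ k
        ≤ 2 * (n * Real.log b) * Real.exp (3 / 4 * (n * Real.log b)) *
          (b * n * Real.exp (-(n * Real.log b))) := by
          rw [div_eq_mul_inv]
          gcongr
      _ = 2 * b * Real.log b * (n ^ 2 *
          (Real.exp (3 / 4 * (n * Real.log b)) * Real.exp (-(n * Real.log b)))) := by ring
      _ = _ := by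
          rw [← Real.exp_add, ← Real.exp_nat_mul]
          congr 4
          ring

theorem tendsto_law_connected (hb : 2 ≤ b) {β : ℝ} (hβ : ((b : ℝ) + 1) / ((b : ℝ) - 1) < β) :
    Tendsto (fun n : ℕ => law b n (sigmaCrit b * n - β * Real.log n) (connectedEvent b n))
      atTop (𝓝 0) := by
  have hb' : (2 : ℝ) ≤ b := by exact_mod_cast hb
  have hlog : 0 < Real.log b := Real.log_pos (by linarith)
  have hc := capacity_pos hb
  set γ := β * capacity b with hγdef
  have hγ : 1 < γ := by
    have h1 : ((b : ℝ) + 1) / ((b : ℝ) - 1) * capacity b = 1 := by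
      have : (b : ℝ) - 1 ≠ 0 := by linarith
      unfold capacity
      field_simp
    rw [← h1]
    exact mul_lt_mul_of_pos_right hβ hc
  have hlim1 : Tendsto (fun n : ℕ => (b : ℝ) ^ 3 * (n : ℝ) ^ (-(γ - 1))) atTop (𝓝 0) := by
    simpa using ((tendsto_rpow_neg_atTop (sub_pos.2 hγ)).comp
      tendsto_natCast_atTop_atTop).const_mul ((b : ℝ) ^ 3)
  have hlim2 : Tendsto (fun n : ℕ => 2 * b * Real.log b * ((n : ℝ) ^ 2 *
      Real.exp (-(Real.log b / 4)) ^ n)) atTop (𝓝 0) := by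
    have := tendsto_pow_const_mul_const_pow_of_abs_lt_one 2
      (r := Real.exp (-(Real.log b / 4)))
      (by rw [abs_of_pos (Real.exp_pos _)]; exact Real.exp_lt_one_iff.2 (by linarith))
    simpa using this.const_mul (2 * b * Real.log b)
  have hlim := ENNReal.tendsto_ofReal (hlim1.add hlim2)
  rw [add_zero, ENNReal.ofReal_zero] at hlim
  refine tendsto_of_tendsto_of_tendsto_of_le_of_le' tendsto_const_nhds hlim
    (Eventually.of_forall fun _ => zero_le) ?_
  -- Makes the parameter nonnegative, so that the Poisson mean is not truncated at 0.
  have hlarge : ∀ᶠ n : ℕ in atTop, γ * Real.log n ≤ n * Real.log b := by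
    have h1 := (Real.isLittleO_log_id_atTop.bound (div_pos hlog (by linarith : 0 < γ)))
    filter_upwards [tendsto_natCast_atTop_atTop.eventually h1, eventually_ge_atTop 1] with n h2 hn
    have hn1 : (1 : ℝ) ≤ n := by exact_mod_cast hn
    rw [Real.norm_of_nonneg (Real.log_nonneg hn1), id, Real.norm_of_nonneg (by linarith),
      div_mul_eq_mul_div, le_div_iff₀ (by linarith)] at h2
    linarith
  filter_upwards [hlarge, eventually_ge_atTop 9] with n h1 hn
  have hlc : (sigmaCrit b * n - β * Real.log n) * capacity b =
      n * Real.log b - γ * Real.log n := by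
    rw [hγdef, ← sigmaCrit_mul_capacity hb]; ring
  have hl : 0 ≤ sigmaCrit b * n - β * Real.log n := by
    by_contra hneg
    push Not at hneg
    have := mul_neg_of_neg_of_pos hneg hc
    linarith
  have h2 := law_connected_le_of_large hb hn hl (by linarith) hlc
  rw [← ofReal_measureReal]
  exact ENNReal.ofReal_le_ofReal h2

end SubcriticalLimit

end ParticleModel

end

theorem mainTheorem5 (b : ℕ) (hb : 2 ≤ b) :
    (∀ α : ℝ, (b : ℝ) + 1 < α →
      Tendsto
        (fun n : ℕ => ParticleModel.law b n (ParticleModel.sigmaCrit b * n + α * Real.log n)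
          (ParticleModel.connectedEvent b n))
        atTop (𝓝 1)) ∧
    (∀ β : ℝ, ((b : ℝ) + 1) / ((b : ℝ) - 1) < β →
      Tendsto
        (fun n : ℕ => ParticleModel.law b n (ParticleModel.sigmaCrit b * n - β * Real.log n)
          (ParticleModel.connectedEvent b n)ᶜ)
        atTop (𝓝 1)) := by
  refine ⟨fun α hα => ParticleModel.tendsto_measure_one_of_compl
    (ParticleModel.tendsto_law_not_connected hb hα), fun β hβ =>
    ParticleModel.tendsto_measure_one_of_compl ?_⟩
  simp_rw [compl_compl]
  exact ParticleModel.tendsto_law_connected hb hβ
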